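/- Let $k$ be a field and let $L$ be either (a) a Lie algebra over $k$, where $\operatorname{char} k=0$, or (b) a restricted Lie algebra over $k$ (in the sense of Jacobson), where $\operatorname{char} k=p>0$. Dimensions are arbitrary. *Notation.* For a Lie algebra $G$ as in (a) let $Q(G)=U(G)$ be its universal enveloping algebra; for a restricted Lie algebra $G$ as in (b) let $Q(G)=U_p(G)$ be its restricted enveloping algebra, i.e. the quotient of $U(G)$ by the two-sided ideal generated by the elements $g^p-g^{[p]}$, $g\in G$. Let $\varepsilon:Q(G)\to k$ be the counit of the Hopf algebra $Q(G)$, i.e. the homomorphism of unital $k$-algebras that vanishes on (the image of) $G$. Let $\langle L,x\rangle$ be the Lie algebra (in case (b): restricted Lie algebra) freely generated by $L$ and one variable $x$; the canonical morphism $L\to\langle L,x\rangle$ induces $Q(L)\to Q(\langle L,x\rangle)$. An element $a\in Q(L)$ is *constant-less* if $\varepsilon(a)=0$, and *universally derivative* if the commutator $[a,x]=ax-xa$, formed in $Q(\langle L,x\rangle)$, belongs to (the image of) $\langle L,x\rangle$. An *extended derivation* of $L$ is a family $\partial=(\partial_f)_f$ consisting of a ($k$-linear, Lie) derivation $\partial_f$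 of $L'$ for every morphism $f:L\to L'$ of Lie algebras over $k$ (in case (b): of restricted Lie algebras over $k$), such that $$g\circ\partial_f=\partial_{g\circ f}\circ g\qquad\text{for all morphisms } f:L\to L',\ g:L'\to L''.$$ Extended derivations form a $k$-vector space under the componentwise operations. Every $a\in L$ defines an extended derivation $\partial_a$ by $\partial_{a,f}(l')=[f(a),l']$ for $f:L\to L'$ and $l'\in L'$. **Theorem.** In each of the cases (a) and (b): 1. an element $a\in Q(L)$ is constant-less and universally derivative if and only if it belongs to (the image of) $L$; 2. the linear map $a\mapsto\partial_a$ is an isomorphism from $L$ onto the vector space of extended derivations of $L$; in particular every extended derivation of $L$ is of the form $\partial_a$ for a unique $a\in L$. -/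

import Mathlib

universe u v w

namespace ExtLie

noncomputable section

/-! ### Restricted Lie algebras -/

section Restricted

/-- Jacobson's expressions `s_i(x, y)`: the element `i • s_i(x, y)` is the coefficient of
`λ ^ (i - 1)` in `ad (λ x + y) ^ (p - 1) (x)`. Here `λ` is the central variable of the polynomial
ring over the (noncommutative) ring of linear endomorphisms of `L`. -/
def jacobsonS (k : Type u) [Field k] {L : Type v} [LieRing L] [LieAlgebra k L]
    (p i : ℕ) (x y : L) : L :=
  ((i : k)⁻¹) •
    (((Polynomial.X * Polynomial.C (LieAlgebra.ad k L x : Module.End k L) +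
        Polynomial.C (LieAlgebra.ad k L y : Module.End k L)) ^ (p - 1)).coeff (i - 1)) x

/-- The structure of a restricted Lie algebra (to be used for a prime `p` and a field `k` of
characteristic `p`) on the Lie algebra `L` over `k`, with `p`-operation `pMap k p : L → L`. -/
class RestrictedLieAlgebra (k : Type u) [Field k] (p : ℕ) (L : Type v) [LieRing L]
    [LieAlgebra k L] where
  pMap : L → L
  pMap_smul : ∀ (c : k) (x : L), pMap (c • x) = c ^ p • pMap x
  pMap_add : ∀ x y : L,
    pMap (x + y) = pMap x + pMap y + ∑ i ∈ Finset.Icc 1 (p - 1), jacobsonS k p i x y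
  ad_pMap : ∀ x : L, LieAlgebra.ad k L (pMap x) = (LieAlgebra.ad k L x) ^ p

/-- The `p`-operation of a restricted Lie algebra. -/
def pMap (k : Type u) [Field k] (p : ℕ) {L : Type v} [LieRing L] [LieAlgebra k L]
    [RestrictedLieAlgebra k p L] (x : L) : L :=
  RestrictedLieAlgebra.pMap k p x

/-- Morphisms of restricted Lie algebras. -/
structure RestrictedLieHom (k : Type u) [Field k] (p : ℕ)
    (L : Type v) [LieRing L] [LieAlgebra k L] [RestrictedLieAlgebra k p L]
    (L' : Type w) [LieRing L'] [LieAlgebra k L'] [RestrictedLieAlgebra k p L'] where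
  toLieHom : L →ₗ⁅k⁆ L'
  map_pMap : ∀ x : L, toLieHom (pMap k p x) = pMap k p (toLieHom x)

/-- Composition of morphisms of restricted Lie algebras. -/
def RestrictedLieHom.comp {k : Type u} [Field k] {p : ℕ}
    {L : Type v} [LieRing L] [LieAlgebra k L] [RestrictedLieAlgebra k p L]
    {L' : Type w} [LieRing L'] [LieAlgebra k L'] [RestrictedLieAlgebra k p L']
    {L'' : Type*} [LieRing L''] [LieAlgebra k L''] [RestrictedLieAlgebra k p L'']
    (g : RestrictedLieHom k p L' L'') (f : RestrictedLieHom k p L L') :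
    RestrictedLieHom k p L L'' where
  toLieHom := g.toLieHom.comp f.toLieHom
  map_pMap x := by simp [f.map_pMap, g.map_pMap]

end Restricted

/-! ### Universal enveloping algebras: counit, functoriality -/

section Enveloping

attribute [local instance] LieRing.ofAssociativeRing

/-- The counit of the Hopf algebra `U(L)`: the homomorphism of algebras that annihilates `L`. -/
def counit (k : Type u) [Field k] (L : Type v) [LieRing L] [LieAlgebra k L] :
    UniversalEnvelopingAlgebra k L →ₐ[k] k :=
  UniversalEnvelopingAlgebra.lift k (0 : L →ₗ⁅k⁆ k)

/-- The homomorphism of algebras `U(L) → U(L')` induced by a morphism `L → L'`. -/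
def envelopingMap {k : Type u} [Field k] {L : Type v} [LieRing L] [LieAlgebra k L]
    {L' : Type w} [LieRing L'] [LieAlgebra k L'] (f : L →ₗ⁅k⁆ L') :
    UniversalEnvelopingAlgebra k L →ₐ[k] UniversalEnvelopingAlgebra k L' :=
  UniversalEnvelopingAlgebra.lift k ((UniversalEnvelopingAlgebra.ι k).comp f)

/-- The relations `a ^ p = a ^ [p]`, for `a ∈ L`, in `U(L)`. -/
inductive RestrictedEnvelopingAlgebra.Rel (k : Type u) [Field k] (p : ℕ)
    (L : Type v) [LieRing L] [LieAlgebra k L] [RestrictedLieAlgebra k p L] :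
    UniversalEnvelopingAlgebra k L → UniversalEnvelopingAlgebra k L → Prop
  | pow (a : L) : RestrictedEnvelopingAlgebra.Rel k p L
      (UniversalEnvelopingAlgebra.ι k a ^ p) (UniversalEnvelopingAlgebra.ι k (pMap k p a))

/-- The restricted enveloping algebra `U_p(L)`, the quotient of `U(L)` by the two-sided ideal
generated by the elements `a ^ p - a ^ [p]`, for `a ∈ L`. -/
abbrev RestrictedEnvelopingAlgebra (k : Type u) [Field k] (p : ℕ)
    (L : Type v) [LieRing L] [LieAlgebra k L] [RestrictedLieAlgebra k p L] : Type (max u v) :=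
  RingQuot (RestrictedEnvelopingAlgebra.Rel k p L)

/-- The counit of the Hopf algebra `U_p(L)`: the homomorphism of algebras that annihilates `L`. -/
def restrictedCounit (k : Type u) [Field k] (p : ℕ) [Fact p.Prime]
    (L : Type v) [LieRing L] [LieAlgebra k L] [RestrictedLieAlgebra k p L] :
    RestrictedEnvelopingAlgebra k p L →ₐ[k] k :=
  RingQuot.liftAlgHom k ⟨counit k L, by
    rintro _ _ ⟨a⟩
    have h : ∀ b : L, counit k L (UniversalEnvelopingAlgebra.ι k b) = 0 := fun b => by
      simp only [counit, UniversalEnvelopingAlgebra.lift_ι_apply, LieHom.zero_apply]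
    rw [map_pow, h, h, zero_pow (Fact.out : p.Prime).ne_zero]⟩

/-- The homomorphism of algebras `U_p(L) → U_p(L')` induced by a morphism `L → L'`. -/
def restrictedEnvelopingMap {k : Type u} [Field k] {p : ℕ}
    {L : Type v} [LieRing L] [LieAlgebra k L] [RestrictedLieAlgebra k p L]
    {L' : Type w} [LieRing L'] [LieAlgebra k L'] [RestrictedLieAlgebra k p L']
    (f : RestrictedLieHom k p L L') :
    RestrictedEnvelopingAlgebra k p L →ₐ[k] RestrictedEnvelopingAlgebra k p L' :=
  RingQuot.liftAlgHom k
    ⟨(RingQuot.mkAlgHom k (RestrictedEnvelopingAlgebra.Rel k p L')).comp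
      (envelopingMap f.toLieHom), by
    rintro _ _ ⟨a⟩
    have h : ∀ b : L, envelopingMap f.toLieHom (UniversalEnvelopingAlgebra.ι k b) =
        UniversalEnvelopingAlgebra.ι k (f.toLieHom b) := fun b => by
      simp only [envelopingMap, UniversalEnvelopingAlgebra.lift_ι_apply, LieHom.comp_apply]
    rw [AlgHom.comp_apply, AlgHom.comp_apply, map_pow, h, h, f.map_pMap]
    exact RingQuot.mkAlgHom_rel k (RestrictedEnvelopingAlgebra.Rel.pow _)⟩

end Enveloping

/-- The canonical map `L → U_p(L)`. -/
def restrictedι (k : Type u) [Field k] (p : ℕ) {L : Type v} [LieRing L] [LieAlgebra k L]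
    [RestrictedLieAlgebra k p L] : L →ₗ[k] RestrictedEnvelopingAlgebra k p L where
  toFun a := RingQuot.mkAlgHom k (RestrictedEnvelopingAlgebra.Rel k p L)
    (UniversalEnvelopingAlgebra.ι k a)
  map_add' a b := by simp only [UniversalEnvelopingAlgebra.ι_apply, map_add]
  map_smul' c a := by
    simp only [UniversalEnvelopingAlgebra.ι_apply, map_smul, RingHom.id_apply]

/-! ### The Lie algebra `⟨L, x⟩` freely generated by `L` and a variable `x` -/

section FreeAdjoin

variable (k : Type u) [Field k] (L : Type v) [LieRing L] [LieAlgebra k L]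

/-- In the free Lie algebra on the set `L ⊔ {x}` (with `x` being `none`), the ideal generated by
the relations that make the map from `L` a morphism of Lie algebras. -/
def freeAdjoinIdeal : LieIdeal k (FreeLieAlgebra k (Option L)) :=
  LieSubmodule.lieSpan k (FreeLieAlgebra k (Option L))
    ({z | ∃ a b : L, z = FreeLieAlgebra.of k (some (a + b)) -
        (FreeLieAlgebra.of k (some a) + FreeLieAlgebra.of k (some b))} ∪
     {z | ∃ (c : k) (a : L), z = FreeLieAlgebra.of k (some (c • a)) -
        c • FreeLieAlgebra.of k (some a)} ∪
     {z | ∃ a b : L, z = FreeLieAlgebra.of k (some ⁅a, b⁆) -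
        ⁅FreeLieAlgebra.of k (some a), FreeLieAlgebra.of k (some b)⁆})

/-- The Lie algebra `⟨L, x⟩` freely generated by the Lie algebra `L` and a variable `x`. -/
abbrev FreeAdjoin : Type (max u v) :=
  FreeLieAlgebra k (Option L) ⧸ freeAdjoinIdeal k L

/-- The variable `x` of `⟨L, x⟩`. -/
def FreeAdjoin.var : FreeAdjoin k L :=
  LieSubmodule.Quotient.mk (FreeLieAlgebra.of k none)

/-- The canonical morphism `L → ⟨L, x⟩`. -/
def FreeAdjoin.incl : L →ₗ⁅k⁆ FreeAdjoin k L where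
  toFun a := LieSubmodule.Quotient.mk (FreeLieAlgebra.of k (some a))
  map_add' a b := (Submodule.Quotient.eq _).2
    (LieSubmodule.subset_lieSpan (Or.inl (Or.inl ⟨a, b, rfl⟩)))
  map_smul' c a := (Submodule.Quotient.eq _).2
    (LieSubmodule.subset_lieSpan (Or.inl (Or.inr ⟨c, a, rfl⟩)))
  map_lie' {a b} := (Submodule.Quotient.eq _).2
    (LieSubmodule.subset_lieSpan (Or.inr ⟨a, b, rfl⟩))

end FreeAdjoin

/-! ### The restricted Lie algebra `⟨L, x⟩` freely generated by `L` and a variable `x`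

It is the set of all formal expressions in the operations of a restricted Lie algebra, in the
elements of `L` and in the variable `x`, modulo the congruence generated by the axioms of restricted
Lie algebras and by the relations that make the map from `L` a morphism. -/

section FormalJacobson

variable {A : Type w} [Zero A] [Add A] [Bracket A A]

/-- `adPowCoeff x y n j` is the coefficient of `λ ^ j` in `ad (λ x + y) ^ n (x)`, as a formal
expression. -/
def adPowCoeff (x y : A) : ℕ → ℕ → A
  | 0, 0 => x
  | 0, _ + 1 => 0
  | n + 1, 0 => ⁅y, adPowCoeff x y n 0⁆
  | n + 1, j + 1 => ⁅y, adPowCoeff x y n (j + 1)⁆ + ⁅x, adPowCoeff x y n j⁆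

/-- The sum of the first `n` of Jacobson's expressions `s_1(x, y), s_2(x, y), …`, as a formal
expression. -/
def jacobsonSum (k : Type u) [Field k] [SMul k A] (p : ℕ) (x y : A) : ℕ → A
  | 0 => 0
  | n + 1 => jacobsonSum k p x y n + (((n + 1 : ℕ) : k)⁻¹) • adPowCoeff x y (p - 1) n

end FormalJacobson

theorem coeff_adPow {k : Type u} [Field k] {L : Type v} [LieRing L] [LieAlgebra k L]
    (x y : L) (n j : ℕ) :
    (((Polynomial.X * Polynomial.C (LieAlgebra.ad k L x : Module.End k L) +
        Polynomial.C (LieAlgebra.ad k L y : Module.End k L)) ^ n).coeff j) x =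
      adPowCoeff x y n j := by
  induction n generalizing j with
  | zero => cases j <;> simp [adPowCoeff, Polynomial.coeff_one]
  | succ n ih =>
    cases j with
    | zero =>
      rw [pow_succ', add_mul, mul_assoc, Polynomial.coeff_add, Polynomial.coeff_X_mul_zero,
        Polynomial.coeff_C_mul, zero_add, Module.End.mul_apply, ih, adPowCoeff,
        LieAlgebra.ad_apply]
    | succ j =>
      rw [pow_succ', add_mul, mul_assoc, Polynomial.coeff_add, Polynomial.coeff_X_mul,
        Polynomial.coeff_C_mul, Polynomial.coeff_C_mul, LinearMap.add_apply,
        Module.End.mul_apply, Module.End.mul_apply, ih, ih, adPowCoeff,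
        LieAlgebra.ad_apply, LieAlgebra.ad_apply, add_comm]

theorem jacobsonSum_eq {k : Type u} [Field k] {L : Type v} [LieRing L] [LieAlgebra k L]
    (p : ℕ) (x y : L) (n : ℕ) :
    jacobsonSum k p x y n = ∑ i ∈ Finset.Icc 1 n, jacobsonS k p i x y := by
  induction n with
  | zero => simp [jacobsonSum]
  | succ n ih =>
    rw [Finset.sum_Icc_succ_top (Nat.le_add_left 1 n), ← ih, jacobsonSum, jacobsonS,
      coeff_adPow, Nat.add_sub_cancel]

/-- Formal expressions in the operations of a restricted Lie algebra over `k`, in the elements of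
`L` and in a variable. -/
inductive RestrictedPre (k : Type u) (L : Type v) : Type (max u v)
  | of (a : L) : RestrictedPre k L
  | var : RestrictedPre k L
  | zero : RestrictedPre k L
  | add (s t : RestrictedPre k L) : RestrictedPre k L
  | smul (c : k) (s : RestrictedPre k L) : RestrictedPre k L
  | lie (s t : RestrictedPre k L) : RestrictedPre k L
  | pth (s : RestrictedPre k L) : RestrictedPre k L

namespace RestrictedPre

variable (k : Type u) (L : Type v)

instance : Zero (RestrictedPre k L) := ⟨zero⟩
instance : Add (RestrictedPre k L) := ⟨add⟩
instance : SMul k (RestrictedPre k L) := ⟨smul⟩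
instance : Bracket (RestrictedPre k L) (RestrictedPre k L) := ⟨lie⟩

variable [Field k] (p : ℕ) [LieRing L] [LieAlgebra k L] [RestrictedLieAlgebra k p L]

/-- The identities to be imposed on formal expressions, closed under the operations. -/
inductive Rel : RestrictedPre k L → RestrictedPre k L → Prop
  -- the axioms of a vector space
  | add_assoc (r s t : RestrictedPre k L) : Rel (r + s + t) (r + (s + t))
  | add_comm (s t : RestrictedPre k L) : Rel (s + t) (t + s)
  | zero_add (s : RestrictedPre k L) : Rel (0 + s) s
  | neg_add (s : RestrictedPre k L) : Rel ((-1 : k) • s + s) 0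
  | one_smul (s : RestrictedPre k L) : Rel ((1 : k) • s) s
  | mul_smul (c d : k) (s : RestrictedPre k L) : Rel ((c * d) • s) (c • d • s)
  | smul_add (c : k) (s t : RestrictedPre k L) : Rel (c • (s + t)) (c • s + c • t)
  | add_smul (c d : k) (s : RestrictedPre k L) : Rel ((c + d) • s) (c • s + d • s)
  -- the axioms of a Lie algebra
  | add_lie (r s t : RestrictedPre k L) : Rel ⁅r + s, t⁆ (⁅r, t⁆ + ⁅s, t⁆)
  | lie_add (r s t : RestrictedPre k L) : Rel ⁅r, s + t⁆ (⁅r, s⁆ + ⁅r, t⁆)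
  | lie_smul (c : k) (s t : RestrictedPre k L) : Rel ⁅s, c • t⁆ (c • ⁅s, t⁆)
  | lie_self (s : RestrictedPre k L) : Rel ⁅s, s⁆ 0
  | leibniz_lie (r s t : RestrictedPre k L) : Rel ⁅r, ⁅s, t⁆⁆ (⁅⁅r, s⁆, t⁆ + ⁅s, ⁅r, t⁆⁆)
  -- the axioms of the `p`-operation
  | pth_smul (c : k) (s : RestrictedPre k L) : Rel (pth (c • s)) (c ^ p • pth s)
  | pth_add (s t : RestrictedPre k L) :
      Rel (pth (s + t)) (pth s + pth t + jacobsonSum k p s t (p - 1))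
  | pth_lie (s t : RestrictedPre k L) : Rel ⁅pth s, t⁆ ((fun r : RestrictedPre k L => ⁅s, r⁆)^[p] t)
  -- the map from `L` is a morphism of restricted Lie algebras
  | of_add (a b : L) : Rel (of (a + b)) (of a + of b)
  | of_smul (c : k) (a : L) : Rel (of (c • a)) (c • of a)
  | of_lie (a b : L) : Rel (of ⁅a, b⁆) ⁅(of a : RestrictedPre k L), (of b : RestrictedPre k L)⁆
  | of_pth (a : L) : Rel (of (pMap k p a)) (pth (of a))
  -- compatibility with the operations
  | add_left (r : RestrictedPre k L) {s t : RestrictedPre k L} : Rel s t → Rel (r + s) (r + t)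
  | add_right (r : RestrictedPre k L) {s t : RestrictedPre k L} : Rel s t → Rel (s + r) (t + r)
  | smul (c : k) {s t : RestrictedPre k L} : Rel s t → Rel (c • s) (c • t)
  | lie_left (r : RestrictedPre k L) {s t : RestrictedPre k L} : Rel s t → Rel ⁅r, s⁆ ⁅r, t⁆
  | lie_right (r : RestrictedPre k L) {s t : RestrictedPre k L} : Rel s t → Rel ⁅s, r⁆ ⁅t, r⁆
  | pth_congr {s t : RestrictedPre k L} : Rel s t → Rel (pth s) (pth t)

end RestrictedPre

/-- The restricted Lie algebra `⟨L, x⟩` freely generated by the restricted Lie algebra `L` and a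
variable `x`. -/
def RestrictedFreeAdjoin (k : Type u) [Field k] (p : ℕ) (L : Type v) [LieRing L] [LieAlgebra k L]
    [RestrictedLieAlgebra k p L] : Type (max u v) :=
  Quot (RestrictedPre.Rel k L p)

namespace RestrictedFreeAdjoin

open RestrictedPre

variable (k : Type u) [Field k] (p : ℕ) (L : Type v) [LieRing L] [LieAlgebra k L]
  [RestrictedLieAlgebra k p L]

/-- The class of a formal expression. -/
def mk (s : RestrictedPre k L) : RestrictedFreeAdjoin k p L := Quot.mk _ s

instance : Zero (RestrictedFreeAdjoin k p L) := ⟨mk k p L 0⟩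

instance : Add (RestrictedFreeAdjoin k p L) :=
  ⟨Quot.map₂ (· + ·) (fun r _ _ h => Rel.add_left r h) (fun _ _ r h => Rel.add_right r h)⟩

instance : SMul k (RestrictedFreeAdjoin k p L) :=
  ⟨fun c => Quot.map (c • ·) (fun _ _ h => Rel.smul c h)⟩

instance : Neg (RestrictedFreeAdjoin k p L) := ⟨fun s => (-1 : k) • s⟩

instance : AddCommGroup (RestrictedFreeAdjoin k p L) where
  add_assoc := by rintro ⟨r⟩ ⟨s⟩ ⟨t⟩; exact Quot.sound (Rel.add_assoc r s t)
  add_comm := by rintro ⟨s⟩ ⟨t⟩; exact Quot.sound (Rel.add_comm s t)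
  zero_add := by rintro ⟨s⟩; exact Quot.sound (Rel.zero_add s)
  add_zero := by
    rintro ⟨s⟩
    exact (Quot.sound (Rel.add_comm s 0)).trans (Quot.sound (Rel.zero_add s))
  neg_add_cancel := by rintro ⟨s⟩; exact Quot.sound (Rel.neg_add s)
  nsmul := nsmulRec
  zsmul := zsmulRec

instance : Module k (RestrictedFreeAdjoin k p L) :=
  Module.ofMinimalAxioms
    (by rintro c ⟨s⟩ ⟨t⟩; exact Quot.sound (Rel.smul_add c s t))
    (by rintro c d ⟨s⟩; exact Quot.sound (Rel.add_smul c d s))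
    (by rintro c d ⟨s⟩; exact Quot.sound (Rel.mul_smul c d s))
    (by rintro ⟨s⟩; exact Quot.sound (Rel.one_smul s))

instance : LieRing (RestrictedFreeAdjoin k p L) where
  bracket := Quot.map₂ (fun s t => ⁅s, t⁆) (fun r _ _ h => Rel.lie_left r h)
    (fun _ _ r h => Rel.lie_right r h)
  add_lie := by rintro ⟨r⟩ ⟨s⟩ ⟨t⟩; exact Quot.sound (Rel.add_lie r s t)
  lie_add := by rintro ⟨r⟩ ⟨s⟩ ⟨t⟩; exact Quot.sound (Rel.lie_add r s t)
  lie_self := by rintro ⟨s⟩; exact Quot.sound (Rel.lie_self s)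
  leibniz_lie := by rintro ⟨r⟩ ⟨s⟩ ⟨t⟩; exact Quot.sound (Rel.leibniz_lie r s t)

instance : LieAlgebra k (RestrictedFreeAdjoin k p L) where
  lie_smul := by rintro c ⟨s⟩ ⟨t⟩; exact Quot.sound (Rel.lie_smul c s t)

theorem mk_adPowCoeff (s t : RestrictedPre k L) (n j : ℕ) :
    mk k p L (adPowCoeff s t n j) = adPowCoeff (mk k p L s) (mk k p L t) n j := by
  induction n generalizing j with
  | zero => cases j <;> rfl
  | succ n ih =>
    cases j with
    | zero => rw [adPowCoeff, adPowCoeff, ← ih]; rfl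
    | succ j => rw [adPowCoeff, adPowCoeff, ← ih, ← ih]; rfl

theorem mk_jacobsonSum (s t : RestrictedPre k L) (n : ℕ) :
    mk k p L (jacobsonSum k p s t n) = jacobsonSum k p (mk k p L s) (mk k p L t) n := by
  induction n with
  | zero => rfl
  | succ n ih => rw [jacobsonSum, jacobsonSum, ← ih, ← mk_adPowCoeff]; rfl

theorem mk_iterate_lie (s t : RestrictedPre k L) (n : ℕ) :
    mk k p L ((fun r : RestrictedPre k L => ⁅s, r⁆)^[n] t) =
      ((LieAlgebra.ad k (RestrictedFreeAdjoin k p L) (mk k p L s)) ^ n) (mk k p L t) := by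
  induction n with
  | zero => rfl
  | succ n ih => rw [Function.iterate_succ_apply', pow_succ', Module.End.mul_apply, ← ih]; rfl

instance : RestrictedLieAlgebra k p (RestrictedFreeAdjoin k p L) where
  pMap := Quot.map RestrictedPre.pth (fun _ _ h => Rel.pth_congr h)
  pMap_smul := by rintro c ⟨s⟩; exact Quot.sound (Rel.pth_smul c s)
  pMap_add := by
    rintro ⟨s⟩ ⟨t⟩
    have h : mk k p L (jacobsonSum k p s t (p - 1)) =
        ∑ i ∈ Finset.Icc 1 (p - 1), jacobsonS k p i (mk k p L s) (mk k p L t) :=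
      (mk_jacobsonSum k p L s t (p - 1)).trans
        (jacobsonSum_eq p (mk k p L s) (mk k p L t) (p - 1))
    exact (Quot.sound (Rel.pth_add s t)).trans
      (congrArg (fun z => mk k p L (pth s) + mk k p L (pth t) + z) h)
  ad_pMap := by
    rintro ⟨s⟩
    ext ⟨t⟩
    exact (Quot.sound (Rel.pth_lie s t)).trans (mk_iterate_lie k p L s t p)

/-- The variable `x` of `⟨L, x⟩`. -/
def var : RestrictedFreeAdjoin k p L := mk k p L RestrictedPre.var

/-- The canonical morphism `L → ⟨L, x⟩`. -/
def incl : RestrictedLieHom k p L (RestrictedFreeAdjoin k p L) where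
  toLieHom :=
    { toFun := fun a => mk k p L (RestrictedPre.of a)
      map_add' := fun a b => Quot.sound (Rel.of_add a b)
      map_smul' := fun c a => Quot.sound (Rel.of_smul c a)
      map_lie' := fun {a b} => Quot.sound (Rel.of_lie a b) }
  map_pMap := fun a => Quot.sound (Rel.of_pth a)

end RestrictedFreeAdjoin

/-! ### Universally derivative elements -/

/-- `a ∈ U(L)` is universally derivative: in `U(⟨L, x⟩)`, the commutator of (the image of) `a` with
`x` belongs to (the image of) `⟨L, x⟩`. -/
def IsUniversallyDerivative (k : Type u) [Field k] (L : Type v) [LieRing L] [LieAlgebra k L]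
    (a : UniversalEnvelopingAlgebra k L) : Prop :=
  envelopingMap (FreeAdjoin.incl k L) a * UniversalEnvelopingAlgebra.ι k (FreeAdjoin.var k L) -
      UniversalEnvelopingAlgebra.ι k (FreeAdjoin.var k L) * envelopingMap (FreeAdjoin.incl k L) a ∈
    Set.range (UniversalEnvelopingAlgebra.ι k :
      FreeAdjoin k L → UniversalEnvelopingAlgebra k (FreeAdjoin k L))

/-- `a ∈ U_p(L)` is universally derivative: in `U_p(⟨L, x⟩)`, the commutator of (the image of) `a`
with `x` belongs to (the image of) the restricted Lie algebra `⟨L, x⟩`. -/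
def IsRestrictedUniversallyDerivative (k : Type u) [Field k] (p : ℕ) (L : Type v) [LieRing L]
    [LieAlgebra k L] [RestrictedLieAlgebra k p L] (a : RestrictedEnvelopingAlgebra k p L) : Prop :=
  restrictedEnvelopingMap (RestrictedFreeAdjoin.incl k p L) a *
        restrictedι k p (RestrictedFreeAdjoin.var k p L) -
      restrictedι k p (RestrictedFreeAdjoin.var k p L) *
        restrictedEnvelopingMap (RestrictedFreeAdjoin.incl k p L) a ∈
    Set.range (restrictedι k p : RestrictedFreeAdjoin k p L →ₗ[k]
      RestrictedEnvelopingAlgebra k p (RestrictedFreeAdjoin k p L))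

/-! ### Extended derivations -/

section ExtendedDerivation

variable (k : Type u) [Field k] (L : Type v) [LieRing L] [LieAlgebra k L]

/-- The vector space of extended derivations of the Lie algebra `L`: families of derivations
`∂ L' f` of `L'`, one for every morphism of Lie algebras `f : L → L'`, such that
`g ∘ ∂ L' f = ∂ L'' (g ∘ f) ∘ g` for all `f : L → L'` and `g : L' → L''`. -/
def ExtendedDerivation :
    Submodule k (∀ (L' : Type (max u v)) [LieRing L'] [LieAlgebra k L'],
      (L →ₗ⁅k⁆ L') → LieDerivation k L' L') where
  carrier := {D | ∀ (L' L'' : Type (max u v)) [LieRing L'] [LieAlgebra k L']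
    [LieRing L''] [LieAlgebra k L''] (f : L →ₗ⁅k⁆ L') (g : L' →ₗ⁅k⁆ L'') (l : L'),
    g (D L' f l) = D L'' (g.comp f) (g l)}
  add_mem' {D E} hD hE := by
    intro L' L'' _ _ _ _ f g l
    change g (D L' f l + E L' f l) = D L'' (g.comp f) (g l) + E L'' (g.comp f) (g l)
    rw [map_add, hD, hE]
  zero_mem' := by
    intro L' L'' _ _ _ _ f g l
    exact map_zero g
  smul_mem' c D hD := by
    intro L' L'' _ _ _ _ f g l
    change g (c • D L' f l) = c • D L'' (g.comp f) (g l)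
    rw [map_smul, hD]

/-- The linear map that sends `a ∈ L` to the extended derivation `∂ L' f = [f(a), -]`. -/
def innerExtendedDerivation : L →ₗ[k] ExtendedDerivation k L where
  toFun a := ⟨fun L' _ _ f => LieDerivation.ad k L' (f a), by
    intro L' L'' _ _ _ _ f g l
    simp [LieDerivation.ad_apply_apply]⟩
  map_add' a b := by
    apply Subtype.ext
    funext L' _ _ f
    change LieDerivation.ad k L' (f (a + b)) =
      LieDerivation.ad k L' (f a) + LieDerivation.ad k L' (f b)
    rw [map_add, map_add]
  map_smul' c a := by
    apply Subtype.ext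
    funext L' _ _ f
    change LieDerivation.ad k L' (f (c • a)) = c • LieDerivation.ad k L' (f a)
    rw [map_smul, map_smul]

variable (p : ℕ) [RestrictedLieAlgebra k p L]

/-- The vector space of extended derivations of the restricted Lie algebra `L`: families of
derivations `∂ L' f` of `L'`, one for every morphism of restricted Lie algebras `f : L → L'`, such
that `g ∘ ∂ L' f = ∂ L'' (g ∘ f) ∘ g` for all `f : L → L'` and `g : L' → L''`. -/
def RestrictedExtendedDerivation :
    Submodule k (∀ (L' : Type (max u v)) [LieRing L'] [LieAlgebra k L']
      [RestrictedLieAlgebra k p L'], RestrictedLieHom k p L L' → LieDerivation k L' L') where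
  carrier := {D | ∀ (L' L'' : Type (max u v)) [LieRing L'] [LieAlgebra k L']
    [RestrictedLieAlgebra k p L'] [LieRing L''] [LieAlgebra k L''] [RestrictedLieAlgebra k p L'']
    (f : RestrictedLieHom k p L L') (g : RestrictedLieHom k p L' L'') (l : L'),
    g.toLieHom (D L' f l) = D L'' (g.comp f) (g.toLieHom l)}
  add_mem' {D E} hD hE := by
    intro L' L'' _ _ _ _ _ _ f g l
    change g.toLieHom (D L' f l + E L' f l) =
      D L'' (g.comp f) (g.toLieHom l) + E L'' (g.comp f) (g.toLieHom l)
    rw [map_add, hD, hE]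
  zero_mem' := by
    intro L' L'' _ _ _ _ _ _ f g l
    exact map_zero g.toLieHom
  smul_mem' c D hD := by
    intro L' L'' _ _ _ _ _ _ f g l
    change g.toLieHom (c • D L' f l) = c • D L'' (g.comp f) (g.toLieHom l)
    rw [map_smul, hD]

/-- The linear map that sends `a ∈ L` to the extended derivation `∂ L' f = [f(a), -]`. -/
def innerRestrictedExtendedDerivation : L →ₗ[k] RestrictedExtendedDerivation k L p where
  toFun a := ⟨fun L' _ _ _ f => LieDerivation.ad k L' (f.toLieHom a), by
    intro L' L'' _ _ _ _ _ _ f g l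
    simp [LieDerivation.ad_apply_apply, RestrictedLieHom.comp]⟩
  map_add' a b := by
    apply Subtype.ext
    funext L' _ _ _ f
    change LieDerivation.ad k L' (f.toLieHom (a + b)) =
      LieDerivation.ad k L' (f.toLieHom a) + LieDerivation.ad k L' (f.toLieHom b)
    rw [map_add, map_add]
  map_smul' c a := by
    apply Subtype.ext
    funext L' _ _ _ f
    change LieDerivation.ad k L' (f.toLieHom (c • a)) = c • LieDerivation.ad k L' (f.toLieHom a)
    rw [map_smul, map_smul]

end ExtendedDerivation

end

end ExtLie

namespace ExtLie

noncomputable section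

attribute [local instance] LieRing.ofAssociativeRing

set_option linter.unusedSectionVars false

open scoped TensorProduct

/-! The key fact is Friedrichs' criterion: an element `a` of `Q(L)` with `ε(a) = 0` and `Δ(a) = a ⊗
1 + 1 ⊗ a` lies in `L`. It rests on the Poincaré–Birkhoff–Witt theorem (`pbwBasis`,
`restrictedPbwBasis`): ordered monomials in a basis `e i` of `L`, with exponents below `p` in the
restricted case, form a basis of `Q(L)`. Contracting `Δ` with the form "coefficient of `e i`"
differentiates such monomials with respect to `e i`. A primitive element has constant derivatives,
and the exponents that occur are invertible in `k`, so only linear and constant terms survive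
(`mem_span_of_primitive`).

Part 1. Put `H = Q(L)` and let `E` be the matrix unit in the upper right corner. Two representations
of `⟨L, x⟩` by `2 × 2` matrices are compared: `θ` sends `l ∈ L` to `diag(Δ l, 1 ⊗ l)` over `H ⊗ H`,
`ψ` sends `l` to `diag(l, 0)` over `H`, and both send `x` to `E`. On generators, `θ` is `ψ ⊗ 1` plus
a scalar matrix with entries in `1 ⊗ H`. The two summands commute, so this persists on all of `⟨L,
x⟩`. If `[a, x]` lies in `⟨L, x⟩`, the upper right entries give `Δ a - 1 ⊗ a = (a - ε a) ⊗ 1`, so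
`a` is primitive when `ε a = 0`.

Part 2. Matrices over `H` with vanishing second row form a Lie algebra: `H` in the upper left corner
acts by left multiplication on a copy of `H` in the upper right corner. Naturality forces an
extended derivation to send the corner element `1` to a corner element `h`, and then, for every `f :
L → L'`, to act on corners over `Q(L')` by left multiplication by the image of `h`. The Leibniz rule
turns this into `∂_f(l) = [f(h), l]` in `Q(L')`. For `f` the inclusion in `⟨L, x⟩` and `l = x` this
says that `h` is universally derivative, so `h - ε(h)` lies in `L` by part 1. Injectivity follows
from `L ⊆ Q(L)`. -/

@[elab_as_elim]
theorem enveloping_induction {k : Type*} [CommRing k] {L : Type*} [LieRing L] [LieAlgebra k L]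
    {p : UniversalEnvelopingAlgebra k L → Prop}
    (algebraMap : ∀ c, p (algebraMap k _ c)) (ι : ∀ x, p (UniversalEnvelopingAlgebra.ι k x))
    (mul : ∀ u v, p u → p v → p (u * v)) (add : ∀ u v, p u → p v → p (u + v))
    (u : UniversalEnvelopingAlgebra k L) : p u := by
  let S : Subalgebra k (UniversalEnvelopingAlgebra k L) :=
    { carrier := {u | p u}
      mul_mem' := fun {u v} => mul u v
      add_mem' := fun {u v} => add u v
      algebraMap_mem' := algebraMap }
  let f : L →ₗ⁅k⁆ S :=
    { toFun := fun x => ⟨UniversalEnvelopingAlgebra.ι k x, ι x⟩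
      map_add' := fun x y => Subtype.ext (map_add _ x y)
      map_smul' := fun c x => Subtype.ext (map_smul _ c x)
      map_lie' := fun {x y} => Subtype.ext (LieHom.map_lie _ x y) }
  -- The two homomorphisms agree on `L`, hence everywhere, so every `u` comes from `S`.
  have h : S.val.comp (UniversalEnvelopingAlgebra.lift k f) = AlgHom.id k _ := by
    ext x
    exact congrArg Subtype.val (UniversalEnvelopingAlgebra.lift_ι_apply k f x)
  have h2 : ((UniversalEnvelopingAlgebra.lift k f u : S) : UniversalEnvelopingAlgebra k L) = u :=
    congrArg (fun g => g u) h
  rw [← h2]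
  exact (UniversalEnvelopingAlgebra.lift k f u).2

/-! ### The Poincaré–Birkhoff–Witt theorem -/

section PBW

/-- The ordered monomial with exponents prescribed by the multiset `α`. -/
def orderedMonomial {I : Type*} [LinearOrder I] {H : Type*} [Monoid H] (e : I → H)
    (α : Multiset I) : H :=
  ((α.sort (· ≤ ·)).map e).prod

section

variable {I : Type*} [LinearOrder I]

theorem orderedMonomial_zero {H : Type*} [Monoid H] (e : I → H) : orderedMonomial e 0 = 1 := by
  simp [orderedMonomial]

theorem orderedMonomial_cons {H : Type*} [Monoid H] (e : I → H) {i : I} {α : Multiset I}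
    (h : ∀ j ∈ α, i ≤ j) : orderedMonomial e (i ::ₘ α) = e i * orderedMonomial e α := by
  simp [orderedMonomial, Multiset.sort_cons _ _ _ h]

theorem orderedMonomial_singleton {H : Type*} [Monoid H] (e : I → H) (i : I) :
    orderedMonomial e {i} = e i := by
  simp [orderedMonomial]

theorem map_orderedMonomial {H H' : Type*} [Monoid H] [Monoid H'] (f : H →* H') (e : I → H)
    (α : Multiset I) : f (orderedMonomial e α) = orderedMonomial (fun i => f (e i)) α := by
  simp [orderedMonomial, map_list_prod, Function.comp_def]

/-- A multiset is built by successively adding elements that are least. -/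
theorem multiset_min_induction {motive : Multiset I → Prop} (zero : motive 0)
    (cons : ∀ i α, (∀ j ∈ α, i ≤ j) → motive α → motive (i ::ₘ α)) (α : Multiset I) :
    motive α := by
  have key : ∀ l : List I, l.Pairwise (· ≤ ·) → motive (l : Multiset I) := by
    intro l
    induction l with
    | nil => intro _; exact zero
    | cons i l ih =>
      intro h
      rw [List.pairwise_cons] at h
      rw [← Multiset.cons_coe]
      exact cons i l (fun j hj => h.1 j hj) (ih h.2)
  rw [← Multiset.sort_eq α (· ≤ ·)]
  exact key _ (Multiset.pairwise_sort _ _)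

end

variable {k : Type*} [CommRing k] {I : Type*}

/-- The span of the monomials of degree at most `n` in the module of polynomials. -/
def degreeLE (k : Type*) [CommRing k] (I : Type*) (n : ℕ) : Submodule k (Multiset I →₀ k) :=
  Finsupp.supported k k {α | α.card ≤ n}

theorem single_mem_degreeLE {α : Multiset I} {n : ℕ} (h : α.card ≤ n) :
    (Finsupp.single α 1 : Multiset I →₀ k) ∈ degreeLE k I n :=
  Finsupp.single_mem_supported k _ h

theorem degreeLE_mono {m n : ℕ} (h : m ≤ n) : degreeLE k I m ≤ degreeLE k I n :=
  Finsupp.supported_mono fun _ hα => le_trans hα h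

theorem exists_mem_degreeLE (s : Multiset I →₀ k) : ∃ n, s ∈ degreeLE k I n := by
  refine ⟨s.support.sup Multiset.card, ?_⟩
  rw [degreeLE, Finsupp.mem_supported]
  intro α hα
  exact Finset.le_sup (f := Multiset.card) hα

@[elab_as_elim]
theorem degreeLE_induction {n : ℕ} {p : (s : Multiset I →₀ k) → s ∈ degreeLE k I n → Prop}
    (single : ∀ (α : Multiset I) (h : α.card ≤ n), p (Finsupp.single α 1) (single_mem_degreeLE h))
    (zero : p 0 (zero_mem _))
    (add : ∀ s t hs ht, p s hs → p t ht → p (s + t) (add_mem hs ht))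
    (smul : ∀ (c : k) s hs, p s hs → p (c • s) (Submodule.smul_mem _ c hs))
    {s : Multiset I →₀ k} (hs : s ∈ degreeLE k I n) : p s hs := by
  have hspan : degreeLE k I n = Submodule.span k
      ((fun α => Finsupp.single α (1 : k)) '' {α : Multiset I | α.card ≤ n}) :=
    Finsupp.supported_eq_span_single k _
  have hs' := hs
  rw [hspan] at hs'
  suffices ∃ h, p s h from this.2
  induction hs' using Submodule.span_induction with
  | mem x hx =>
    obtain ⟨α, hα, rfl⟩ := hx
    exact ⟨_, single α hα⟩
  | zero => exact ⟨_, zero⟩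
  | add x y hx hy ihx ihy =>
    obtain ⟨h1, h1'⟩ := ihx (by rwa [hspan])
    obtain ⟨h2, h2'⟩ := ihy (by rwa [hspan])
    exact ⟨_, add _ _ h1 h2 h1' h2'⟩
  | smul c x hx ihx =>
    obtain ⟨h1, h1'⟩ := ihx (by rwa [hspan])
    exact ⟨_, smul c _ h1 h1'⟩

@[elab_as_elim]
theorem basis_induction {V : Type*} [AddCommGroup V] [Module k V] (b : Module.Basis I k V)
    {p : V → Prop} (mem : ∀ i, p (b i)) (zero : p 0) (add : ∀ x y, p x → p y → p (x + y))
    (smul : ∀ (c : k) x, p x → p (c • x)) (x : V) : p x := by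
  have hx : x ∈ Submodule.span k (Set.range b) := by rw [b.span_eq]; trivial
  refine Submodule.span_induction ?_ zero (fun x y _ _ => add x y) (fun c x _ => smul c x) hx
  rintro _ ⟨i, rfl⟩
  exact mem i

variable [LinearOrder I] {L : Type*} [LieRing L] [LieAlgebra k L] (b : Module.Basis I k L)

/-- Approximations to the action of a Lie algebra on polynomials, correct up to degree `n`. -/
def pbwApprox : ℕ → L →ₗ[k] (Multiset I →₀ k) →ₗ[k] (Multiset I →₀ k)
  | 0 => b.constr k fun i =>
      Finsupp.linearCombination k fun α : Multiset I => Finsupp.single (i ::ₘ α) (1 : k)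
  | n + 1 => b.constr k fun i =>
      Finsupp.linearCombination k fun α : Multiset I =>
        match α.sort (· ≤ ·) with
        | [] => Finsupp.single (i ::ₘ α) (1 : k)
        -- Here `j` is the least element of `α`. For `j < i` the value is forced by `b i * b j = b j
        -- * b i + ⁅b i, b j⁆`: the leading term of `b i` on `l` is `i ::ₘ l`, which `b j` has to
        -- send to `i ::ₘ α`. The recursive calls only need to be correct up to degree `l.length`.
        | j :: l =>
          if i ≤ j then Finsupp.single (i ::ₘ α) (1 : k)
          else Finsupp.single (i ::ₘ α) (1 : k) +
            pbwApprox n (b j) (pbwApprox n (b i) (Finsupp.single (l : Multiset I) 1) -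
              Finsupp.single (i ::ₘ (l : Multiset I)) 1) +
            pbwApprox n ⁅b i, b j⁆ (Finsupp.single (l : Multiset I) 1)

theorem pbwApprox_zero (i : I) (α : Multiset I) :
    pbwApprox b 0 (b i) (Finsupp.single α 1) = Finsupp.single (i ::ₘ α) 1 := by
  simp [pbwApprox]

theorem pbwApprox_of_le (n : ℕ) {i : I} {α : Multiset I} (h : ∀ j ∈ α, i ≤ j) :
    pbwApprox b n (b i) (Finsupp.single α 1) = Finsupp.single (i ::ₘ α) 1 := by
  cases n with
  | zero => exact pbwApprox_zero b i α
  | succ n =>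
    simp only [pbwApprox, Module.Basis.constr_basis, Finsupp.linearCombination_single, one_smul]
    split
    · rfl
    · rename_i j l hl
      have hj : j ∈ α := by rw [← Multiset.mem_sort (· ≤ ·), hl]; simp
      rw [if_pos (h j hj)]

theorem pbwApprox_succ (n : ℕ) {i j : I} {β : Multiset I} (hij : j < i) (h : ∀ m ∈ β, j ≤ m) :
    pbwApprox b (n + 1) (b i) (Finsupp.single (j ::ₘ β) 1) =
      Finsupp.single (i ::ₘ j ::ₘ β) 1 +
        pbwApprox b n (b j) (pbwApprox b n (b i) (Finsupp.single β 1) -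
          Finsupp.single (i ::ₘ β) 1) + pbwApprox b n ⁅b i, b j⁆ (Finsupp.single β 1) := by
  have hs : (j ::ₘ β).sort (· ≤ ·) = j :: β.sort (· ≤ ·) := Multiset.sort_cons _ _ _ h
  simp only [pbwApprox, Module.Basis.constr_basis, Finsupp.linearCombination_single, one_smul,
    hs, if_neg (not_le.2 hij), Multiset.sort_eq]

/-- A linear family of operators raising the degree on basis elements raises the degree. -/
theorem map_mem_degreeLE (A : L →ₗ[k] (Multiset I →₀ k) →ₗ[k] (Multiset I →₀ k)) {m : ℕ}
    (h : ∀ i (α : Multiset I), α.card ≤ m →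
      A (b i) (Finsupp.single α 1) - Finsupp.single (i ::ₘ α) 1 ∈ degreeLE k I α.card)
    (x : L) {s : Multiset I →₀ k} {n : ℕ} (hn : n ≤ m) (hs : s ∈ degreeLE k I n) :
    A x s ∈ degreeLE k I (n + 1) := by
  induction hs using degreeLE_induction with
  | single α hα =>
    induction x using basis_induction b with
    | zero => simp
    | add x y hx hy => rw [map_add, LinearMap.add_apply]; exact add_mem hx hy
    | smul c x hx => rw [map_smul, LinearMap.smul_apply]; exact Submodule.smul_mem _ _ hx
    | mem i =>
      have h1 := degreeLE_mono (hα.trans (Nat.le_succ n)) (h i α (hα.trans hn))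
      have h2 : (Finsupp.single (i ::ₘ α) 1 : Multiset I →₀ k) ∈ degreeLE k I (n + 1) :=
        single_mem_degreeLE (by simpa using hα)
      simpa using add_mem h1 h2
  | zero => simp
  | add s t _ _ hs ht => rw [map_add]; exact add_mem hs ht
  | smul c s _ hs => rw [map_smul]; exact Submodule.smul_mem _ _ hs

/-- Both correction terms apply operators of the previous level to polynomials of degree at most
`β.card`, so their degree is at most `β.card + 1`, the degree of the monomial `j ::ₘ β`. -/
theorem pbwApprox_sub_mem (n : ℕ) (i : I) (α : Multiset I) :
    pbwApprox b n (b i) (Finsupp.single α 1) - Finsupp.single (i ::ₘ α) 1 ∈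
      degreeLE k I α.card := by
  induction n generalizing i α with
  | zero => simp [pbwApprox_zero]
  | succ n ih =>
    by_cases h : ∀ j ∈ α, i ≤ j
    · simp [pbwApprox_of_le b _ h]
    induction α using multiset_min_induction with
    | zero => simp at h
    | cons j β hj _ =>
      have hij : j < i := by
        by_contra! hij
        exact h fun m hm => by
          rcases Multiset.mem_cons.1 hm with rfl | hm
          · exact hij
          · exact hij.trans (hj m hm)
      have key := fun x s (hs : s ∈ degreeLE k I β.card) =>
        map_mem_degreeLE b (pbwApprox b n) (m := β.card) (fun i α _ => ih i α) x le_rfl hs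
      rw [pbwApprox_succ b n hij hj, add_assoc, add_sub_cancel_left, Multiset.card_cons]
      exact add_mem (key _ _ (ih i β)) (key _ _ (single_mem_degreeLE le_rfl))

theorem pbwApprox_mem (n : ℕ) (x : L) {s : Multiset I →₀ k} {m : ℕ} (hs : s ∈ degreeLE k I m) :
    pbwApprox b n x s ∈ degreeLE k I (m + 1) :=
  map_mem_degreeLE b _ (fun i α _ => pbwApprox_sub_mem b n i α) x le_rfl hs

/-- On a monomial of degree `n + 1`, the recursion calls the previous level only on polynomials of
degree at most `n`, where induction applies. Hence level `n` is final up to degree `n`. -/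
theorem pbwApprox_stable (n : ℕ) (x : L) {s : Multiset I →₀ k} (hs : s ∈ degreeLE k I n) :
    pbwApprox b (n + 1) x s = pbwApprox b n x s := by
  induction n generalizing x s with
  | zero =>
    induction hs using degreeLE_induction with
    | single α hα =>
      induction x using basis_induction b with
      | zero => simp
      | add x y hx hy => simp only [map_add, LinearMap.add_apply, hx, hy]
      | smul c x hx => simp only [map_smul, LinearMap.smul_apply, hx]
      | mem i =>
        obtain rfl : α = 0 := Multiset.card_eq_zero.1 (Nat.le_zero.1 hα)
        rw [pbwApprox_of_le _ _ (by simp), pbwApprox_of_le _ _ (by simp)]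
    | zero => simp
    | add s t _ _ hs ht => rw [map_add, map_add, hs, ht]
    | smul c s _ hs => rw [map_smul, map_smul, hs]
  | succ n ih =>
    induction hs using degreeLE_induction with
    | single α hα =>
      induction x using basis_induction b with
      | zero => simp
      | add x y hx hy => simp only [map_add, LinearMap.add_apply, hx, hy]
      | smul c x hx => simp only [map_smul, LinearMap.smul_apply, hx]
      | mem i =>
        by_cases h : ∀ j ∈ α, i ≤ j
        · rw [pbwApprox_of_le _ _ h, pbwApprox_of_le _ _ h]
        induction α using multiset_min_induction with
        | zero => simp at h
        | cons j β hj _ =>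
          have hij : j < i := by
            by_contra! hij
            exact h fun m hm => by
              rcases Multiset.mem_cons.1 hm with rfl | hm
              · exact hij
              · exact hij.trans (hj m hm)
          have hβ : β.card ≤ n := by simpa using hα
          have h1 : (Finsupp.single β 1 : Multiset I →₀ k) ∈ degreeLE k I n :=
            single_mem_degreeLE hβ
          rw [pbwApprox_succ b _ hij hj, pbwApprox_succ b _ hij hj, ih _ h1, ih _ h1,
            ih _ (degreeLE_mono hβ (pbwApprox_sub_mem b n i β))]
    | zero => simp
    | add s t _ _ hs ht => rw [map_add, map_add, hs, ht]
    | smul c s _ hs => rw [map_smul, map_smul, hs]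

theorem pbwApprox_eq {m n : ℕ} (h : n ≤ m) (x : L) {s : Multiset I →₀ k}
    (hs : s ∈ degreeLE k I n) : pbwApprox b m x s = pbwApprox b n x s := by
  induction h with
  | refl => rfl
  | step h ih => rw [pbwApprox_stable b _ x (degreeLE_mono h hs), ih]

/-- The action of a Lie algebra on polynomials in the elements of a basis. -/
def pbwAct : L →ₗ[k] (Multiset I →₀ k) →ₗ[k] (Multiset I →₀ k) :=
  (Finsupp.linearCombination k fun α : Multiset I =>
    (pbwApprox b α.card).flip (Finsupp.single α 1)).flip

theorem pbwAct_eq {n : ℕ} (x : L) {s : Multiset I →₀ k} (hs : s ∈ degreeLE k I n) :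
    pbwAct b x s = pbwApprox b n x s := by
  induction hs using degreeLE_induction with
  | single α hα =>
    rw [pbwApprox_eq b hα x (single_mem_degreeLE le_rfl)]
    simp [pbwAct]
  | zero => simp
  | add s t _ _ hs ht => rw [map_add, map_add, hs, ht]
  | smul c s _ hs => rw [map_smul, map_smul, hs]

theorem pbwAct_of_le {i : I} {α : Multiset I} (h : ∀ j ∈ α, i ≤ j) :
    pbwAct b (b i) (Finsupp.single α 1) = Finsupp.single (i ::ₘ α) 1 := by
  rw [pbwAct_eq b _ (single_mem_degreeLE le_rfl), pbwApprox_of_le b _ h]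

theorem pbwAct_sub_mem (i : I) (α : Multiset I) :
    pbwAct b (b i) (Finsupp.single α 1) - Finsupp.single (i ::ₘ α) 1 ∈ degreeLE k I α.card := by
  rw [pbwAct_eq b _ (single_mem_degreeLE le_rfl)]
  exact pbwApprox_sub_mem b _ i α

theorem pbwAct_mem (x : L) {s : Multiset I →₀ k} {m : ℕ} (hs : s ∈ degreeLE k I m) :
    pbwAct b x s ∈ degreeLE k I (m + 1) := by
  rw [pbwAct_eq b x hs]
  exact pbwApprox_mem b _ x hs

/-- The recursion freed of approximations: since `j` is least, the leading monomial is `b j` applied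
to `i ::ₘ β`, and it merges with the correction term. -/
theorem pbwAct_cons {i j : I} {β : Multiset I} (hij : j < i) (h : ∀ m ∈ β, j ≤ m) :
    pbwAct b (b i) (Finsupp.single (j ::ₘ β) 1) =
      pbwAct b (b j) (pbwAct b (b i) (Finsupp.single β 1)) +
        pbwAct b ⁅b i, b j⁆ (Finsupp.single β 1) := by
  have h1 : (Finsupp.single β 1 : Multiset I →₀ k) ∈ degreeLE k I β.card :=
    single_mem_degreeLE le_rfl
  have h2 : pbwAct b (b j) (Finsupp.single (i ::ₘ β) 1) = Finsupp.single (i ::ₘ j ::ₘ β) 1 := by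
    rw [pbwAct_of_le, Multiset.cons_swap]
    intro m hm
    rcases Multiset.mem_cons.1 hm with rfl | hm
    exacts [hij.le, h m hm]
  rw [pbwAct_eq (n := β.card + 1) b (b i) (single_mem_degreeLE (by simp)),
    pbwApprox_succ b _ hij h, ← pbwAct_eq b _ h1, ← pbwAct_eq b _ h1,
    ← pbwAct_eq b _ (pbwAct_sub_mem b i β), map_sub, h2, add_sub_cancel]

/-- The operators `pbwAct b x` define a Lie module structure. -/
theorem pbwAct_lie (x y : L) (s : Multiset I →₀ k) :
    pbwAct b ⁅x, y⁆ s = pbwAct b x (pbwAct b y s) - pbwAct b y (pbwAct b x s) := by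
  suffices H : ∀ n, ∀ s ∈ degreeLE k I n, ∀ x y : L,
      pbwAct b ⁅x, y⁆ s = pbwAct b x (pbwAct b y s) - pbwAct b y (pbwAct b x s) by
    obtain ⟨n, hn⟩ := exists_mem_degreeLE s
    exact H n s hn x y
  intro n
  induction n using Nat.strong_induction_on with
  | _ n ih =>
  intro s hs
  induction hs using degreeLE_induction with
  | zero => simp
  | add s t _ _ hs ht => intro x y; simp only [map_add, hs, ht]; abel
  | smul c s _ hs => intro x y; simp only [map_smul, hs, smul_sub]
  | single γ hγ =>
    -- it suffices to treat basis elements in decreasing order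
    suffices H : ∀ i j, j < i → pbwAct b ⁅b i, b j⁆ (Finsupp.single γ 1) =
        pbwAct b (b i) (pbwAct b (b j) (Finsupp.single γ 1)) -
          pbwAct b (b j) (pbwAct b (b i) (Finsupp.single γ 1)) by
      intro x y
      induction x using basis_induction b with
      | zero => simp
      | add x x' hx hx' => simp only [add_lie, map_add, LinearMap.add_apply, hx, hx']; abel
      | smul c x hx => simp only [smul_lie, map_smul, LinearMap.smul_apply, hx, smul_sub]
      | mem i =>
        induction y using basis_induction b with
        | zero => simp
        | add y y' hy hy' => simp only [lie_add, map_add, LinearMap.add_apply, hy, hy']; abel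
        | smul c y hy => simp only [lie_smul, map_smul, LinearMap.smul_apply, hy, smul_sub]
        | mem j =>
          rcases lt_trichotomy i j with h | rfl | h
          · rw [← lie_skew, map_neg, LinearMap.neg_apply, H _ _ h, neg_sub]
          · simp
          · exact H _ _ h
    -- When `j` is least, `b j` only prepends `j`, and the relation is the recursion that defines
    -- the action of `b i`.
    have easy : ∀ i j (β : Multiset I), j < i → (∀ m ∈ β, j ≤ m) →
        pbwAct b ⁅b i, b j⁆ (Finsupp.single β 1) =
          pbwAct b (b i) (pbwAct b (b j) (Finsupp.single β 1)) -
            pbwAct b (b j) (pbwAct b (b i) (Finsupp.single β 1)) := by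
      intro i j β hij hj
      rw [pbwAct_of_le b hj, pbwAct_cons b hij hj, add_sub_cancel_left]
    intro i j hij
    by_cases hj : ∀ m ∈ γ, j ≤ m
    · exact easy i j γ hij hj
    induction γ using multiset_min_induction with
    | zero => simp at hj
    -- Now `l < j < i`, and the monomial is `b l` applied to `d`. Moving `b l` to the left, by
    -- relations already known, reduces the claim to the Jacobi identity.
    | cons l δ hl _ =>
      have hlj : l < j := by
        by_contra! hlj
        exact hj fun m hm => by
          rcases Multiset.mem_cons.1 hm with rfl | hm
          · exact hlj
          · exact hlj.trans (hl m hm)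
      have hδ : δ.card < n := by simpa using hγ
      set d : Multiset I →₀ k := Finsupp.single δ 1 with hd
      have hdm : d ∈ degreeLE k I δ.card := single_mem_degreeLE le_rfl
      have IH := fun x y => ih _ hδ d hdm x y
      have hcons : ∀ m, l ≤ m → ∀ q ∈ m ::ₘ δ, l ≤ q := by
        intro m hm q hq
        rcases Multiset.mem_cons.1 hq with rfl | hq
        exacts [hm, hl q hq]
      -- the Lie relation for a larger basis element and `b l`, on the image of `d`
      have step : ∀ q r, l < q → l < r → pbwAct b ⁅b q, b l⁆ (pbwAct b (b r) d) =
          pbwAct b (b q) (pbwAct b (b l) (pbwAct b (b r) d)) -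
            pbwAct b (b l) (pbwAct b (b q) (pbwAct b (b r) d)) := by
        intro q r hq hr
        -- `b r` applied to `d` is the monomial `r ::ₘ δ`, for which `l` is least, plus terms of
        -- degree at most `δ.card < n`, covered by induction.
        have e1 := easy q l (r ::ₘ δ) hq (hcons r hr.le)
        have e2 := ih _ hδ _ (pbwAct_sub_mem b r δ) (b q) (b l)
        rw [← sub_add_cancel (pbwAct b (b r) d) (Finsupp.single (r ::ₘ δ) 1)]
        simp only [map_add, e1, hd, e2]
        abel
      have hz : Finsupp.single (l ::ₘ δ) (1 : k) = pbwAct b (b l) d := (pbwAct_of_le b hl).symm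
      have hi : pbwAct b (b i) (pbwAct b (b l) d) =
          pbwAct b (b l) (pbwAct b (b i) d) + pbwAct b ⁅b i, b l⁆ d := by
        rw [IH]; abel
      have hjj : pbwAct b (b j) (pbwAct b (b l) d) =
          pbwAct b (b l) (pbwAct b (b j) d) + pbwAct b ⁅b j, b l⁆ d := by
        rw [IH]; abel
      have s1 := step i j (hlj.trans hij) hlj
      have s2 := step j i hlj (hlj.trans hij)
      have jac : ⁅⁅b i, b j⁆, b l⁆ = ⁅b i, ⁅b j, b l⁆⁆ - ⁅b j, ⁅b i, b l⁆⁆ := by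
        rw [leibniz_lie (b i) (b j) (b l)]; abel
      have t0 := IH ⁅b i, b j⁆ (b l)
      have t1 := IH (b i) ⁅b j, b l⁆
      have t2 := IH (b j) ⁅b i, b l⁆
      have t3 := IH (b i) (b j)
      rw [jac, map_sub, LinearMap.sub_apply, t1, t2] at t0
      rw [hz, hjj, hi, map_add, map_add]
      have t0' : pbwAct b ⁅b i, b j⁆ (pbwAct b (b l) d) =
          pbwAct b (b i) (pbwAct b ⁅b j, b l⁆ d) - pbwAct b ⁅b j, b l⁆ (pbwAct b (b i) d) -
          (pbwAct b (b j) (pbwAct b ⁅b i, b l⁆ d) - pbwAct b ⁅b i, b l⁆ (pbwAct b (b j) d)) +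
          pbwAct b (b l) (pbwAct b ⁅b i, b j⁆ d) := by
        rw [t0]; abel
      rw [t0', t3, s1, s2, map_sub]
      abel

/-- The Lie module structure on polynomials in the elements of a basis. -/
def pbwRep : L →ₗ⁅k⁆ Module.End k (Multiset I →₀ k) where
  __ := pbwAct b
  map_lie' {x y} := by
    ext1 α
    ext1
    simp only [LieRing.of_associative_ring_bracket]
    exact pbwAct_lie b x y _

/-- The evaluation at `1` of the action of the enveloping algebra on polynomials. -/
def pbwEval : UniversalEnvelopingAlgebra k L →ₗ[k] (Multiset I →₀ k) :=
  (LinearMap.applyₗ (Finsupp.single 0 1 : Multiset I →₀ k)).comp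
    (UniversalEnvelopingAlgebra.lift k (pbwRep b)).toLinearMap

theorem pbwEval_apply (u : UniversalEnvelopingAlgebra k L) :
    pbwEval b u = UniversalEnvelopingAlgebra.lift k (pbwRep b) u (Finsupp.single 0 1) := rfl

theorem pbwEval_one : pbwEval b 1 = Finsupp.single 0 1 := by
  simp [pbwEval_apply]

theorem pbwEval_ι_mul (x : L) (u : UniversalEnvelopingAlgebra k L) :
    pbwEval b (UniversalEnvelopingAlgebra.ι k x * u) = pbwAct b x (pbwEval b u) := by
  rw [pbwEval_apply, map_mul, UniversalEnvelopingAlgebra.lift_ι_apply]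
  rfl

theorem pbwEval_orderedMonomial (α : Multiset I) :
    pbwEval b (orderedMonomial (fun i => UniversalEnvelopingAlgebra.ι k (b i)) α) =
      Finsupp.single α 1 := by
  induction α using multiset_min_induction with
  | zero => rw [orderedMonomial_zero, pbwEval_one]
  | cons i α h ih => rw [orderedMonomial_cons _ h, pbwEval_ι_mul, ih, pbwAct_of_le b h]

/-- The linear map from polynomials to the enveloping algebra given by ordered monomials. -/
def pbwSection : (Multiset I →₀ k) →ₗ[k] UniversalEnvelopingAlgebra k L :=
  Finsupp.linearCombination k (orderedMonomial fun i => UniversalEnvelopingAlgebra.ι k (b i))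

/-- The recursion of the action imitates the straightening of products in the enveloping algebra, so
the section is `L`-linear. This is the half of the theorem that says that ordered monomials span. -/
theorem pbwSection_act (x : L) (s : Multiset I →₀ k) :
    pbwSection b (pbwAct b x s) = UniversalEnvelopingAlgebra.ι k x * pbwSection b s := by
  suffices H : ∀ n, ∀ s ∈ degreeLE k I n, ∀ x : L,
      pbwSection b (pbwAct b x s) = UniversalEnvelopingAlgebra.ι k x * pbwSection b s by
    obtain ⟨n, hn⟩ := exists_mem_degreeLE s
    exact H n s hn x
  intro n
  induction n using Nat.strong_induction_on with
  | _ n ih =>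
  intro s hs x
  induction hs using degreeLE_induction with
  | zero => simp
  | add s t _ _ hs ht => simp only [map_add, hs, ht, mul_add]
  | smul c s _ hs => simp only [map_smul, hs, mul_smul_comm]
  | single α hα =>
    induction x using basis_induction b with
    | zero => simp
    | add x x' hx hx' => simp only [map_add, LinearMap.add_apply, hx, hx', add_mul]
    | smul c x hx => simp only [map_smul, LinearMap.smul_apply, hx, smul_mul_assoc]
    | mem i =>
      have easy : ∀ i (β : Multiset I), (∀ j ∈ β, i ≤ j) →
          pbwSection b (pbwAct b (b i) (Finsupp.single β 1)) =
            UniversalEnvelopingAlgebra.ι k (b i) * pbwSection b (Finsupp.single β 1) := by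
        intro i β h
        rw [pbwAct_of_le b h]
        simp only [pbwSection, Finsupp.linearCombination_single, one_smul,
          orderedMonomial_cons _ h]
      by_cases h : ∀ j ∈ α, i ≤ j
      · exact easy i α h
      induction α using multiset_min_induction with
      | zero => simp at h
      | cons j β hj _ =>
        have hij : j < i := by
          by_contra! hij
          exact h fun m hm => by
            rcases Multiset.mem_cons.1 hm with rfl | hm
            · exact hij
            · exact hij.trans (hj m hm)
        have hβ : β.card < n := by simpa using hα
        have IH := ih _ hβ (Finsupp.single β 1) (single_mem_degreeLE le_rfl)
        -- Split off the leading monomial `i ::ₘ β`, for which `j` is least; the remainder has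
        -- degree at most `β.card`, so induction applies to it.
        have e1 : pbwSection b (pbwAct b (b j) (pbwAct b (b i) (Finsupp.single β 1))) =
            UniversalEnvelopingAlgebra.ι k (b j) *
              pbwSection b (pbwAct b (b i) (Finsupp.single β 1)) := by
          have e2 := easy j (i ::ₘ β) (by
            intro m hm
            rcases Multiset.mem_cons.1 hm with rfl | hm
            exacts [hij.le, hj m hm])
          have e3 := ih _ hβ _ (pbwAct_sub_mem b i β) (b j)
          rw [← sub_add_cancel (pbwAct b (b i) (Finsupp.single β 1))
            (Finsupp.single (i ::ₘ β) 1)]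
          simp only [map_add, e2, e3, mul_add]
        rw [pbwAct_cons b hij hj, map_add, e1, IH, IH, LieHom.map_lie,
          LieRing.of_associative_ring_bracket, ← pbwAct_of_le b hj, easy j β hj]
        noncomm_ring

/-- By linearity over the enveloping algebra, the section sends `u` applied to the empty monomial to
`u * 1`. -/
theorem pbwSection_eval (u : UniversalEnvelopingAlgebra k L) : pbwSection b (pbwEval b u) = u := by
  have key : ∀ (v : UniversalEnvelopingAlgebra k L) (s : Multiset I →₀ k),
      pbwSection b (UniversalEnvelopingAlgebra.lift k (pbwRep b) v s) = v * pbwSection b s := by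
    intro v
    induction v using enveloping_induction with
    | algebraMap c => intro s; simp [Algebra.smul_def]
    | ι x =>
      intro s
      rw [UniversalEnvelopingAlgebra.lift_ι_apply]
      exact pbwSection_act b x s
    | mul u v hu hv => intro s; rw [map_mul, Module.End.mul_apply, hu, hv, mul_assoc]
    | add u v hu hv => intro s; rw [map_add, LinearMap.add_apply, map_add, hu, hv, add_mul]
  rw [pbwEval_apply, key]
  simp [pbwSection, orderedMonomial_zero]

/-- The Poincaré–Birkhoff–Witt theorem: the enveloping algebra has a basis of ordered monomials. -/
def pbwBasis : Module.Basis (Multiset I) k (UniversalEnvelopingAlgebra k L) :=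
  Module.Basis.ofRepr (LinearEquiv.ofLinearMap (pbwEval b) (pbwSection b)
    (by
      ext1 α
      ext1
      simpa [pbwSection] using pbwEval_orderedMonomial b α)
    (by
      ext1 u
      exact pbwSection_eval b u))

theorem pbwBasis_apply (α : Multiset I) :
    pbwBasis b α = orderedMonomial (fun i => UniversalEnvelopingAlgebra.ι k (b i)) α := by
  change pbwSection b (Finsupp.single α 1) = _
  simp [pbwSection]

theorem pbwBasis_repr (u : UniversalEnvelopingAlgebra k L) : (pbwBasis b).repr u = pbwEval b u :=
  rfl

end PBW

/-! ### Jacobson's formula in associative algebras -/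

section Jacobson

/-- Pascal's rule and `p ∣ p.choose (m + 1)` make consecutive values opposite. -/
theorem choose_sub_one_eq (k : Type*) [Ring k] (p : ℕ) [hp : Fact p.Prime] [CharP k p]
    {m : ℕ} (hm : m ≤ p - 1) : ((p - 1).choose m : k) = (-1) ^ m := by
  induction m with
  | zero => simp
  | succ m ih =>
    have h1 : (p.choose (m + 1) : k) = 0 := by
      rw [CharP.cast_eq_zero_iff k p]
      exact hp.out.dvd_choose_self (Nat.succ_ne_zero m) (by have := hp.out.pos; omega)
    have h2 : p.choose (m + 1) = (p - 1).choose m + (p - 1).choose (m + 1) := by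
      obtain ⟨n, rfl⟩ := Nat.exists_eq_succ_of_ne_zero hp.out.ne_zero
      rfl
    rw [h2, Nat.cast_add, ih (by omega)] at h1
    rw [pow_succ, mul_neg_one]
    exact (neg_eq_of_add_eq_zero_right h1).symm

variable (k : Type*) [Field k] (p : ℕ) [hp : Fact p.Prime] [CharP k p]
  {A : Type*} [Ring A] [Algebra k A]

theorem add_pow_prime_of_commute (k : Type*) [Field k] (p : ℕ) [hp : Fact p.Prime] [CharP k p]
    {A : Type*} [Ring A] [Algebra k A] {x y : A} (h : Commute x y) :
    (x + y) ^ p = x ^ p + y ^ p := by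
  cases subsingleton_or_nontrivial A
  · exact Subsingleton.elim _ _
  · have := charP_of_injective_algebraMap (algebraMap k A).injective p
    exact add_pow_char_of_commute p h

theorem sub_pow_prime_of_commute (k : Type*) [Field k] (p : ℕ) [hp : Fact p.Prime] [CharP k p]
    {A : Type*} [Ring A] [Algebra k A] {x y : A} (h : Commute x y) :
    (x - y) ^ p = x ^ p - y ^ p := by
  cases subsingleton_or_nontrivial A
  · exact Subsingleton.elim _ _
  · have := charP_of_injective_algebraMap (algebraMap k A).injective p
    exact sub_pow_char_of_commute p h

/-- The binomial coefficient of `p - 1` over `j` is `(-1) ^ (p - 1 - j)` in `k`, which cancels the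
sign of the power of `-y`. -/
theorem sub_pow_prime_sub_one_of_commute (k : Type*) [Field k] (p : ℕ) [hp : Fact p.Prime] [CharP k p]
    {A : Type*} [Ring A] [Algebra k A] {x y : A} (h : Commute x y) :
    (x - y) ^ (p - 1) = ∑ j ∈ Finset.range p, x ^ j * y ^ (p - 1 - j) := by
  rw [sub_eq_add_neg, h.neg_right.add_pow, Nat.sub_add_cancel hp.out.one_le]
  refine Finset.sum_congr rfl fun j hj => ?_
  have hj' : j ≤ p - 1 := by have := Finset.mem_range.1 hj; omega
  have h1 : (((p - 1).choose j : ℕ) : A) = algebraMap k A ((-1) ^ (p - 1 - j)) := by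
    rw [← Nat.choose_symm hj', ← choose_sub_one_eq k p (Nat.sub_le _ _), map_natCast]
  rw [h1, map_pow, map_neg, map_one, mul_assoc, neg_pow y, mul_assoc,
    ← ((Commute.neg_one_left _).pow_left _).eq, ← mul_assoc ((-1 : A) ^ _), ← pow_add, ← two_mul]
  simp

theorem ad_eq_mulLeft_sub_mulRight (x : A) :
    LieAlgebra.ad k A x = LinearMap.mulLeft k x - LinearMap.mulRight k x := by
  ext y
  simp [LieRing.of_associative_ring_bracket]

/-- Left and right multiplication by `x` commute, so the `p`-th power is additive on their
difference. -/
theorem ad_pow_prime (x : A) : LieAlgebra.ad k A (x ^ p) = LieAlgebra.ad k A x ^ p := by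
  rw [ad_eq_mulLeft_sub_mulRight, ad_eq_mulLeft_sub_mulRight,
    sub_pow_prime_of_commute k p (LinearMap.commute_mulLeft_right x x),
    LinearMap.pow_mulLeft, LinearMap.pow_mulRight]

theorem ad_pow_prime_sub_one_apply (x y : A) :
    (LieAlgebra.ad k A x ^ (p - 1)) y =
      ∑ j ∈ Finset.range p, x ^ j * y * x ^ (p - 1 - j) := by
  rw [ad_eq_mulLeft_sub_mulRight,
    sub_pow_prime_sub_one_of_commute k p (LinearMap.commute_mulLeft_right x x),
    LinearMap.sum_apply]
  refine Finset.sum_congr rfl fun j _ => ?_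
  rw [LinearMap.pow_mulLeft, LinearMap.pow_mulRight]
  simp [mul_assoc]

open Polynomial in
theorem derivative_pow_noncomm {R : Type*} [Semiring R] (P : R[X]) (n : ℕ) :
    derivative (P ^ n) = ∑ j ∈ Finset.range n, P ^ j * derivative P * P ^ (n - 1 - j) := by
  induction n with
  | zero => simp
  | succ n ih =>
    rw [pow_succ, derivative_mul, ih, Finset.sum_range_succ, Finset.sum_mul]
    congr 1
    · refine Finset.sum_congr rfl fun j hj => ?_
      have := Finset.mem_range.1 hj
      rw [mul_assoc, ← pow_succ]
      congr 2
      omega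
    · simp

-- Because `X` is central, bracketing with `X * C x + C y` acts on coefficients by the recursion of
-- `adPowCoeff`. This lets identities in `A[X]` be read as identities between Jacobson's
-- expressions.
open Polynomial in
theorem coeff_ad_pow_linear (x y : A) (n j : ℕ) :
    ((LieAlgebra.ad k A[X] (X * C x + C y) ^ n) (C x)).coeff j = adPowCoeff x y n j := by
  induction n generalizing j with
  | zero => cases j <;> simp [adPowCoeff, coeff_C]
  | succ n ih =>
    rw [pow_succ', Module.End.mul_apply, LieAlgebra.ad_apply,
      LieRing.of_associative_ring_bracket, add_mul, mul_add, ← mul_assoc _ X (C x), ← X_mul,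
      mul_assoc, mul_assoc]
    cases j with
    | zero =>
      simp only [coeff_sub, coeff_add, coeff_X_mul_zero, coeff_C_mul, coeff_mul_C, ih, adPowCoeff,
        LieRing.of_associative_ring_bracket, zero_add]
    | succ j =>
      simp only [coeff_sub, coeff_add, coeff_X_mul, coeff_C_mul, coeff_mul_C, ih, adPowCoeff,
        LieRing.of_associative_ring_bracket]
      abel

open Polynomial in
theorem eval_one_pow_linear (x y : A) (n : ℕ) :
    (x + y) ^ n = ∑ i ∈ Finset.range (n + 1), ((X * C x + C y) ^ n).coeff i := by
  -- Evaluation at `1` is multiplicative over a noncommutative ring because `1` is central.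
  let φ : A[X] →+* A := eval₂RingHom' (RingHom.id A) 1 fun a => Commute.one_right _
  have h1 : φ ((X * C x + C y) ^ n) = (x + y) ^ n := by
    rw [map_pow, map_add, map_mul]
    simp [φ]
  have h2 : φ ((X * C x + C y) ^ n) = ((X * C x + C y) ^ n).eval 1 := rfl
  have hd : ((X * C x + C y) ^ n).natDegree < n + 1 := by
    refine Nat.lt_succ_of_le (natDegree_pow_le_of_le n ?_ |>.trans_eq (mul_one n))
    compute_degree
  rw [← h1, h2, eval_eq_sum_range' hd]
  simp

open Polynomial in
/-- Jacobson's formula. -/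
theorem add_pow_prime (x y : A) :
    (x + y) ^ p = x ^ p + y ^ p + ∑ i ∈ Finset.Icc 1 (p - 1), jacobsonS k p i x y := by
  obtain ⟨n, hn⟩ := Nat.exists_eq_succ_of_ne_zero hp.out.ne_zero
  have h0 : ((X * C x + C y) ^ p).coeff 0 = y ^ p := by
    rw [← constantCoeff_apply, map_pow]
    simp
  have htop : ((X * C x + C y) ^ p).coeff p = x ^ p := by
    have := coeff_pow_of_natDegree_le (p := X * C x + C y) (m := p) (n := 1)
      (by compute_degree)
    rw [mul_one] at this
    rw [this]
    simp [coeff_C]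
  -- With `P = X * C x + C y`, the derivative of `P ^ p` is the sum of the `P ^ j * C x * P ^ (p - 1
  -- - j)`, which in characteristic `p` is `ad(P) ^ (p - 1)` applied to `C x`. Compare coefficients
  -- of `X ^ i` and divide by `i + 1 < p`.
  have hmid : ∀ i ∈ Finset.range n, ((X * C x + C y) ^ p).coeff (i + 1) =
      jacobsonS k p (i + 1) x y := by
    intro i hi
    have hi' := Finset.mem_range.1 hi
    have hk : ((i + 1 : ℕ) : k) ≠ 0 := by
      intro h
      rw [CharP.cast_eq_zero_iff k p] at h
      have := Nat.le_of_dvd (Nat.succ_pos i) h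
      omega
    have e1 := congrArg (fun P => coeff P i) (derivative_pow_noncomm (X * C x + C y) p)
    have e2 : derivative (X * C x + C y) = C x := by simp
    simp only [e2] at e1
    rw [← ad_pow_prime_sub_one_apply k p, coeff_ad_pow_linear, coeff_derivative] at e1
    rw [jacobsonS, coeff_adPow, Nat.add_sub_cancel, ← e1, eq_inv_smul_iff₀ hk, Algebra.smul_def,
      map_natCast, ← Nat.cast_succ, (Nat.cast_commute _ _).eq]
  rw [eval_one_pow_linear, Finset.sum_range_succ, htop, hn, Finset.sum_range_succ', ← hn, h0,
    Finset.sum_congr rfl hmid, Finset.range_eq_Ico,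
    Finset.sum_Ico_add' (fun i => jacobsonS k p i x y) 0 n 1, zero_add, hn]
  have hI : Finset.Ico 1 (n + 1) = Finset.Icc 1 (n.succ - 1) := by ext; simp
  rw [hI]
  abel

/-- An associative algebra is a restricted Lie algebra by its `p`-th power map. -/
@[reducible]
def RestrictedLieAlgebra.ofAssociativeAlgebra : RestrictedLieAlgebra k p A where
  pMap x := x ^ p
  pMap_smul c x := smul_pow c x p
  pMap_add := add_pow_prime k p
  ad_pMap := ad_pow_prime k p

end Jacobson

/-! ### The Poincaré–Birkhoff–Witt theorem for restricted Lie algebras -/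

/-! ### Leading terms of the action on polynomials -/

section Symbol

variable {k : Type*} [CommRing k] {I : Type*}

/-- The span of the monomials of degree less than `n` in the module of polynomials. -/
def degreeLT (k : Type*) [CommRing k] (I : Type*) (n : ℕ) : Submodule k (Multiset I →₀ k) :=
  Finsupp.supported k k {α | α.card < n}

theorem degreeLT_succ (n : ℕ) : degreeLT k I (n + 1) = degreeLE k I n := by
  simp only [degreeLT, degreeLE, Nat.lt_succ_iff]

theorem degreeLT_zero : degreeLT k I 0 = ⊥ := by
  simp [degreeLT]

theorem degreeLT_mono {m n : ℕ} (h : m ≤ n) : degreeLT k I m ≤ degreeLT k I n :=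
  Finsupp.supported_mono fun _ hα => lt_of_lt_of_le hα h

theorem map_mem_degreeLT {f : (Multiset I →₀ k) →ₗ[k] (Multiset I →₀ k)} {d : ℕ}
    (hf : ∀ α : Multiset I, f (Finsupp.single α 1) ∈ degreeLT k I (d + α.card + 1)) {n : ℕ}
    {s : Multiset I →₀ k} (hs : s ∈ degreeLT k I n) : f s ∈ degreeLT k I (d + n) := by
  cases n with
  | zero =>
    rw [degreeLT_zero, Submodule.mem_bot] at hs
    rw [hs, map_zero]
    exact zero_mem _
  | succ n =>
    rw [degreeLT_succ] at hs
    induction hs using degreeLE_induction with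
    | single α hα => exact degreeLT_mono (by omega) (hf α)
    | zero => simp
    | add s t _ _ hs ht => rw [map_add]; exact add_mem hs ht
    | smul c s _ hs => rw [map_smul]; exact Submodule.smul_mem _ _ hs

/-- A unitriangular endomorphism of the module of polynomials is bijective. -/
theorem bijective_of_unitriangular (f : (Multiset I →₀ k) →ₗ[k] (Multiset I →₀ k))
    (hf : ∀ α : Multiset I,
      f (Finsupp.single α 1) - Finsupp.single α 1 ∈ degreeLT k I α.card) :
    Function.Bijective f := by
  -- `f` is the identity plus an operator that lowers the degree; injectivity and surjectivity then
  -- follow by induction on the degree.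
  have hlow : ∀ n, ∀ s ∈ degreeLT k I (n + 1), f s - s ∈ degreeLT k I n := by
    intro n s hs
    rw [degreeLT_succ] at hs
    induction hs using degreeLE_induction with
    | single α hα => exact degreeLT_mono hα (hf α)
    | zero => simp
    | add s t _ _ hs ht =>
      rw [map_add, add_sub_add_comm]
      exact add_mem hs ht
    | smul c s _ hs =>
      rw [map_smul, ← smul_sub]
      exact Submodule.smul_mem _ _ hs
  have hall : ∀ s : Multiset I →₀ k, ∃ n, s ∈ degreeLT k I n := fun s =>
    let ⟨n, hn⟩ := exists_mem_degreeLE s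
    ⟨n + 1, by rwa [degreeLT_succ]⟩
  constructor
  · rw [injective_iff_map_eq_zero]
    intro s hs
    obtain ⟨n, hn⟩ := hall s
    induction n with
    | zero => rwa [degreeLT_zero, Submodule.mem_bot] at hn
    | succ n ih =>
      apply ih
      have := hlow n s hn
      rwa [hs, zero_sub, neg_mem_iff] at this
  · intro s
    obtain ⟨n, hn⟩ := hall s
    induction n generalizing s with
    | zero =>
      rw [degreeLT_zero, Submodule.mem_bot] at hn
      exact ⟨0, by rw [hn, map_zero]⟩
    | succ n ih =>
      obtain ⟨t, ht⟩ := ih _ (hlow n s hn)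
      exact ⟨s - t, by rw [map_sub, ht, sub_sub_cancel]⟩

variable [LinearOrder I] {L : Type*} [LieRing L] [LieAlgebra k L] (b : Module.Basis I k L)

/-- The element `u` of the enveloping algebra acts on polynomials, up to terms of lower degree, as
the multiplication by the monomial with exponent `α`. -/
def HasSymbol (u : UniversalEnvelopingAlgebra k L) (α : Multiset I) : Prop :=
  ∀ β : Multiset I, UniversalEnvelopingAlgebra.lift k (pbwRep b) u (Finsupp.single β 1) -
    Finsupp.single (α + β) 1 ∈ degreeLT k I (α.card + β.card)

theorem lift_pbwRep_ι (x : L) (s : Multiset I →₀ k) :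
    UniversalEnvelopingAlgebra.lift k (pbwRep b) (UniversalEnvelopingAlgebra.ι k x) s =
      pbwAct b x s := by
  rw [UniversalEnvelopingAlgebra.lift_ι_apply]
  rfl

variable {b}

theorem HasSymbol.one : HasSymbol b 1 0 := by
  intro β
  simp

theorem HasSymbol.map_mem {u : UniversalEnvelopingAlgebra k L} {α : Multiset I}
    (hu : HasSymbol b u α) {n : ℕ} {s : Multiset I →₀ k} (hs : s ∈ degreeLT k I n) :
    UniversalEnvelopingAlgebra.lift k (pbwRep b) u s ∈ degreeLT k I (α.card + n) := by
  refine map_mem_degreeLT (fun β => ?_) hs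
  have h2 : (Finsupp.single (α + β) 1 : Multiset I →₀ k) ∈
      degreeLT k I (α.card + β.card + 1) := by
    rw [degreeLT_succ]
    exact single_mem_degreeLE (by simp)
  simpa using add_mem (degreeLT_mono (Nat.le_succ _) (hu β)) h2

/-- `v` sends the monomial `γ` to `β + γ` plus lower terms; `u` adds `α` to the former, and by
`HasSymbol.map_mem` it raises the degree of the latter by at most `α.card`. -/
theorem HasSymbol.mul {u v : UniversalEnvelopingAlgebra k L} {α β : Multiset I}
    (hu : HasSymbol b u α) (hv : HasSymbol b v β) : HasSymbol b (u * v) (α + β) := by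
  intro γ
  have h1 := hu.map_mem (hv γ)
  have h2 := hu (β + γ)
  rw [map_sub] at h1
  rw [Multiset.card_add] at h2
  rw [map_mul, Module.End.mul_apply, Multiset.card_add, add_assoc, add_assoc]
  simpa using add_mem h1 h2

theorem HasSymbol.pow {u : UniversalEnvelopingAlgebra k L} {α : Multiset I}
    (hu : HasSymbol b u α) (n : ℕ) : HasSymbol b (u ^ n) (n • α) := by
  induction n with
  | zero => simpa using HasSymbol.one
  | succ n ih =>
    rw [pow_succ, succ_nsmul]
    exact ih.mul hu

theorem HasSymbol.basis (i : I) : HasSymbol b (UniversalEnvelopingAlgebra.ι k (b i)) {i} := by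
  intro β
  rw [lift_pbwRep_ι, Multiset.singleton_add, Multiset.card_singleton, add_comm 1, degreeLT_succ]
  exact pbwAct_sub_mem b i β

theorem HasSymbol.orderedMonomial (α : Multiset I) :
    HasSymbol b (orderedMonomial (fun i => UniversalEnvelopingAlgebra.ι k (b i)) α) α := by
  induction α using multiset_min_induction with
  | zero => rw [orderedMonomial_zero]; exact HasSymbol.one
  | cons i α h ih =>
    rw [orderedMonomial_cons _ h, ← Multiset.singleton_add]
    exact (HasSymbol.basis i).mul ih

end Symbol

/-! ### Division of exponents by `p` with remainder -/

section DivMod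

variable {I : Type*} [DecidableEq I]

/-- The multiset with the multiplicities of `α` divided by `p`. -/
def multisetDiv (p : ℕ) (α : Multiset I) : Multiset I :=
  ∑ i ∈ α.toFinset, (α.count i / p) • {i}

/-- The multiset with the multiplicities of `α` reduced modulo `p`. -/
def multisetMod (p : ℕ) (α : Multiset I) : Multiset I :=
  ∑ i ∈ α.toFinset, (α.count i % p) • {i}

theorem count_multisetDiv (p : ℕ) (α : Multiset I) (i : I) :
    (multisetDiv p α).count i = α.count i / p := by
  simp only [multisetDiv, Multiset.count_sum', Multiset.count_nsmul, Multiset.count_singleton,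
    mul_ite, mul_one, mul_zero, Finset.sum_ite_eq, Multiset.mem_toFinset]
  split_ifs with h
  · rfl
  · simp [Multiset.count_eq_zero_of_notMem h]

theorem count_multisetMod (p : ℕ) (α : Multiset I) (i : I) :
    (multisetMod p α).count i = α.count i % p := by
  simp only [multisetMod, Multiset.count_sum', Multiset.count_nsmul, Multiset.count_singleton,
    mul_ite, mul_one, mul_zero, Finset.sum_ite_eq, Multiset.mem_toFinset]
  split_ifs with h
  · rfl
  · simp [Multiset.count_eq_zero_of_notMem h]

theorem multisetDiv_add_multisetMod (p : ℕ) (α : Multiset I) :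
    p • multisetDiv p α + multisetMod p α = α := by
  ext i
  simp [count_multisetDiv, count_multisetMod, Nat.div_add_mod]

theorem multisetDiv_add {p : ℕ} (hp : 0 < p) (α : Multiset I) (i : I) :
    multisetDiv p (p • {i} + α) = i ::ₘ multisetDiv p α := by
  ext j
  by_cases h : j = i
  · subst h
    simp [count_multisetDiv, Nat.add_div_left, hp]
  · simp [count_multisetDiv, h]

theorem multisetMod_add (p : ℕ) (α : Multiset I) (i : I) :
    multisetMod p (p • {i} + α) = multisetMod p α := by
  ext j
  simp [count_multisetMod]

theorem multisetMod_of_lt {p : ℕ} {α : Multiset I} (h : ∀ i, α.count i < p) :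
    multisetMod p α = α := by
  ext i
  rw [count_multisetMod, Nat.mod_eq_of_lt (h i)]

theorem multisetDiv_of_lt {p : ℕ} {α : Multiset I} (h : ∀ i, α.count i < p) :
    multisetDiv p α = 0 := by
  ext i
  rw [count_multisetDiv, Nat.div_eq_of_lt (h i), Multiset.count_zero]

end DivMod

/-! ### Lie morphisms and Jacobson's expressions -/

section FormalMaps

theorem map_adPowCoeff {k : Type*} [CommRing k] {L L' : Type*} [LieRing L] [LieAlgebra k L]
    [LieRing L'] [LieAlgebra k L'] (f : L →ₗ⁅k⁆ L') (x y : L) (n j : ℕ) :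
    f (adPowCoeff x y n j) = adPowCoeff (f x) (f y) n j := by
  induction n generalizing j with
  | zero => cases j <;> simp [adPowCoeff]
  | succ n ih => cases j <;> simp [adPowCoeff, ih]

theorem map_jacobsonS {k : Type*} [Field k] {L L' : Type*} [LieRing L] [LieAlgebra k L]
    [LieRing L'] [LieAlgebra k L'] (f : L →ₗ⁅k⁆ L') (p i : ℕ) (x y : L) :
    f (jacobsonS k p i x y) = jacobsonS k p i (f x) (f y) := by
  rw [jacobsonS, jacobsonS, coeff_adPow, coeff_adPow, map_smul, map_adPowCoeff]

theorem map_ad_pow_apply {k : Type*} [CommRing k] {L L' : Type*} [LieRing L] [LieAlgebra k L]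
    [LieRing L'] [LieAlgebra k L'] (f : L →ₗ⁅k⁆ L') (x y : L) (n : ℕ) :
    f ((LieAlgebra.ad k L x ^ n) y) = (LieAlgebra.ad k L' (f x) ^ n) (f y) := by
  induction n with
  | zero => simp
  | succ n ih => simp [pow_succ', ih]

end FormalMaps

/-- If a left ideal contains the right multiples of the relations, then it contains the kernel of
the map to the quotient by the relations. -/
theorem mem_of_mkAlgHom_eq_zero {k : Type*} [CommRing k] {U : Type*} [Ring U] [Algebra k U]
    (N : Submodule U U) {r : U → U → Prop} (hr : ∀ x y, r x y → ∀ w, (x - y) * w ∈ N) {u : U}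
    (hu : RingQuot.mkAlgHom k r u = 0) : u ∈ N := by
  let σ : U →ₐ[k] Module.End k (U ⧸ N) := Algebra.lsmul k k (U ⧸ N)
  have hσ : ∀ u v, σ u (N.mkQ v) = N.mkQ (u * v) := fun u v => rfl
  have hrel : ∀ ⦃x y⦄, r x y → σ x = σ y := by
    intro x y h
    rw [← sub_eq_zero, ← map_sub]
    refine LinearMap.ext fun w => ?_
    obtain ⟨w, rfl⟩ := N.mkQ_surjective w
    rw [hσ, LinearMap.zero_apply, Submodule.mkQ_apply, Submodule.Quotient.mk_eq_zero]
    exact hr x y h w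
  have h1 : σ u = 0 := by
    rw [← RingQuot.liftAlgHom_mkAlgHom_apply k σ hrel, hu, map_zero]
  have h2 := hσ u 1
  rw [h1, LinearMap.zero_apply, mul_one] at h2
  exact (Submodule.Quotient.mk_eq_zero N).1 h2.symm

/-! ### The central elements `x ^ p - x ^ [p]` and the restricted basis -/

section RestrictedPBW

variable (k : Type*) [Field k] (p : ℕ) [hp : Fact p.Prime] [CharP k p]
  {L : Type*} [LieRing L] [LieAlgebra k L] [RestrictedLieAlgebra k p L]

/-- The element `x ^ p - x ^ [p]` of the enveloping algebra. -/
def pDefect (x : L) : UniversalEnvelopingAlgebra k L :=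
  UniversalEnvelopingAlgebra.ι k x ^ p - UniversalEnvelopingAlgebra.ι k (pMap k p x)

/-- Jacobson's formula in `U(L)` and the axiom for the `p`-operation of `L` produce the same
correction terms, which cancel. -/
theorem pDefect_add (x y : L) : pDefect k p (x + y) = pDefect k p x + pDefect k p y := by
  have h : UniversalEnvelopingAlgebra.ι k (pMap k p (x + y)) =
      UniversalEnvelopingAlgebra.ι k (pMap k p x) + UniversalEnvelopingAlgebra.ι k (pMap k p y) +
        ∑ i ∈ Finset.Icc 1 (p - 1), jacobsonS k p i (UniversalEnvelopingAlgebra.ι k x)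
          (UniversalEnvelopingAlgebra.ι k y) := by
    have : pMap k p (x + y) = pMap k p x + pMap k p y +
        ∑ i ∈ Finset.Icc 1 (p - 1), jacobsonS k p i x y := RestrictedLieAlgebra.pMap_add x y
    rw [this, map_add, map_add, map_sum]
    simp only [map_jacobsonS]
  rw [pDefect, h, map_add, add_pow_prime k p, pDefect, pDefect]
  abel

theorem pDefect_smul (c : k) (x : L) : pDefect k p (c • x) = c ^ p • pDefect k p x := by
  have : pMap k p (c • x) = c ^ p • pMap k p x := RestrictedLieAlgebra.pMap_smul c x
  rw [pDefect, this, map_smul, map_smul, smul_pow, ← smul_sub, pDefect]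

/-- On the generators `L`, bracketing with `x ^ p` and with `x ^ [p]` are both `ad(x) ^ p`. -/
theorem commute_pDefect (x : L) (u : UniversalEnvelopingAlgebra k L) :
    Commute (pDefect k p x) u := by
  induction u using enveloping_induction with
  | algebraMap c => exact Algebra.commute_algebraMap_right c _
  | ι y =>
    have h : LieAlgebra.ad k L (pMap k p x) = LieAlgebra.ad k L x ^ p :=
      RestrictedLieAlgebra.ad_pMap x
    have h1 := map_ad_pow_apply (UniversalEnvelopingAlgebra.ι k) x y p
    rw [← h, ← ad_pow_prime k p, LieAlgebra.ad_apply, LieAlgebra.ad_apply, LieHom.map_lie,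
      LieRing.of_associative_ring_bracket, LieRing.of_associative_ring_bracket] at h1
    rw [commute_iff_eq, pDefect, sub_mul, mul_sub, sub_eq_sub_iff_sub_eq_sub]
    exact h1.symm
  | mul u v hu hv => exact hu.mul_right hv
  | add u v hu hv => exact hu.add_right hv

/-- The element `x ^ p - x ^ [p]` of the center of the enveloping algebra. -/
def pDefectCenter (x : L) : Subalgebra.center k (UniversalEnvelopingAlgebra k L) :=
  ⟨pDefect k p x, Subalgebra.mem_center_iff.2 fun u => ((commute_pDefect k p x u).eq).symm⟩

variable {I : Type*} [LinearOrder I] (b : Module.Basis I k L)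

/-- The product of the elements `x ^ p - x ^ [p]`, for `x` in the multiset `α` of basis elements. -/
def pDefectMonomial (α : Multiset I) : UniversalEnvelopingAlgebra k L :=
  ((α.map fun i => pDefectCenter k p (b i)).prod :
    Subalgebra.center k (UniversalEnvelopingAlgebra k L))

theorem pDefectMonomial_zero : pDefectMonomial k p b 0 = 1 := by
  simp [pDefectMonomial]

theorem pDefectMonomial_cons (i : I) (α : Multiset I) :
    pDefectMonomial k p b (i ::ₘ α) = pDefect k p (b i) * pDefectMonomial k p b α := by
  simp [pDefectMonomial, pDefectCenter]

/-- The term `x ^ [p]` raises degrees by at most `1 < p`, so the symbol is that of `x ^ p`. -/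
theorem HasSymbol.pDefect (i : I) : HasSymbol b (pDefect k p (b i)) (p • {i}) := by
  intro β
  have h1 := (HasSymbol.basis (b := b) i).pow p β
  have h2 : pbwAct b (pMap k p (b i)) (Finsupp.single β 1) ∈
      degreeLT k I ((p • ({i} : Multiset I)).card + β.card) := by
    have h3 := pbwAct_mem b (pMap k p (b i)) (single_mem_degreeLE (k := k) (le_refl β.card))
    rw [← degreeLT_succ] at h3
    refine degreeLT_mono ?_ h3
    have := hp.out.two_le
    simp
    omega
  have h4 := sub_mem h1 h2
  rw [ExtLie.pDefect, map_sub, LinearMap.sub_apply, lift_pbwRep_ι]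
  rwa [sub_right_comm] at h4

theorem HasSymbol.pDefectMonomial (α : Multiset I) :
    HasSymbol b (pDefectMonomial k p b α) (p • α) := by
  induction α using Multiset.induction_on with
  | empty => simpa [pDefectMonomial_zero] using HasSymbol.one
  | cons i α ih =>
    rw [pDefectMonomial_cons, ← Multiset.singleton_add, nsmul_add]
    exact (HasSymbol.pDefect k p b i).mul ih

/-- The products of an ordered monomial with exponents less than `p` and of central elements. -/
def mixedMonomial (α : Multiset I) : UniversalEnvelopingAlgebra k L :=
  pDefectMonomial k p b (multisetDiv p α) *
    orderedMonomial (fun i => UniversalEnvelopingAlgebra.ι k (b i)) (multisetMod p α)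

theorem HasSymbol.mixedMonomial (α : Multiset I) : HasSymbol b (mixedMonomial k p b α) α := by
  have := (HasSymbol.pDefectMonomial k p b (multisetDiv p α)).mul
    (HasSymbol.orderedMonomial (b := b) (multisetMod p α))
  rwa [multisetDiv_add_multisetMod] at this

/-- Central factors can be collected without reordering. Multiplication by a generator of the ideal
thus sends mixed monomials to mixed monomials with some exponent at least `p`, which makes the ideal
visible in the basis. -/
theorem mixedMonomial_add (α : Multiset I) (i : I) :
    mixedMonomial k p b (p • {i} + α) = mixedMonomial k p b α * pDefect k p (b i) := by
  rw [mixedMonomial, multisetDiv_add hp.out.pos, multisetMod_add, pDefectMonomial_cons, mul_assoc]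
  exact commute_pDefect k p (b i) _

theorem mixedMonomial_of_lt {α : Multiset I} (h : ∀ i, α.count i < p) :
    mixedMonomial k p b α = orderedMonomial (fun i => UniversalEnvelopingAlgebra.ι k (b i)) α := by
  rw [mixedMonomial, multisetDiv_of_lt h, multisetMod_of_lt h, pDefectMonomial_zero, one_mul]

/-- The basis of the enveloping algebra given by the mixed monomials. -/
def mixedBasis : Module.Basis (Multiset I) k (UniversalEnvelopingAlgebra k L) :=
  (Finsupp.basisSingleOne (R := k)).map
    ((LinearEquiv.ofBijective
      (Finsupp.linearCombination k fun α => pbwEval b (mixedMonomial k p b α))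
      -- Evaluating the symbol at the empty monomial shows that mixed monomials are unitriangular
      -- with respect to ordered monomials.
      (bijective_of_unitriangular _ fun α => by
        have := HasSymbol.mixedMonomial k p b α 0
        rw [add_zero, Multiset.card_zero, add_zero] at this
        simpa [pbwEval_apply] using this)).trans (pbwBasis b).repr.symm)

theorem mixedBasis_apply (α : Multiset I) : mixedBasis k p b α = mixedMonomial k p b α := by
  rw [mixedBasis, Module.Basis.map_apply, LinearEquiv.trans_apply, LinearEquiv.symm_apply_eq,
    pbwBasis_repr]
  simp

/-- The left ideal generated by the central elements `x ^ p - x ^ [p]`. -/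
def pDefectIdeal : Submodule (UniversalEnvelopingAlgebra k L) (UniversalEnvelopingAlgebra k L) :=
  Submodule.span _ (Set.range fun i => pDefect k p (b i))

/-- The defect is additive and `p`-semilinear, so its values on a basis suffice. -/
theorem pDefect_mem (x : L) : pDefect k p x ∈ pDefectIdeal k p b := by
  induction x using basis_induction b with
  | mem i => exact Submodule.subset_span ⟨i, rfl⟩
  | zero =>
    have := pDefect_smul k p 0 (0 : L)
    rw [smul_zero, zero_pow hp.out.ne_zero, zero_smul] at this
    rw [this]
    exact zero_mem _
  | add x y hx hy => rw [pDefect_add]; exact add_mem hx hy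
  | smul c x hx =>
    rw [pDefect_smul, Algebra.smul_def]
    exact Submodule.smul_mem _ _ hx

/-- As the generators are central, the left ideal absorbs multiplication on the right as well. -/
theorem mem_pDefectIdeal_of_mk_eq_zero {u : UniversalEnvelopingAlgebra k L}
    (hu : RingQuot.mkAlgHom k (RestrictedEnvelopingAlgebra.Rel k p L) u = 0) :
    u ∈ pDefectIdeal k p b := by
  refine mem_of_mkAlgHom_eq_zero (pDefectIdeal k p b) ?_ hu
  rintro _ _ ⟨x⟩ w
  change pDefect k p x * w ∈ _
  rw [(commute_pDefect k p x w).eq]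
  exact Submodule.smul_mem _ _ (pDefect_mem k p b x)

open Classical in
/-- The projection to the span of the ordered monomials with exponents less than `p`. -/
def restrictedProjection : UniversalEnvelopingAlgebra k L →ₗ[k] (Multiset I →₀ k) :=
  (mixedBasis k p b).constr k fun α =>
    if ∀ i, α.count i < p then Finsupp.single α 1 else 0

theorem restrictedProjection_of_lt {α : Multiset I} (h : ∀ i, α.count i < p) :
    restrictedProjection k p b (mixedMonomial k p b α) = Finsupp.single α 1 := by
  rw [← mixedBasis_apply, restrictedProjection, Module.Basis.constr_basis, if_pos h]

theorem restrictedProjection_mul (u : UniversalEnvelopingAlgebra k L) (i : I) :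
    restrictedProjection k p b (u * pDefect k p (b i)) = 0 := by
  induction u using basis_induction (mixedBasis k p b) with
  | mem α =>
    rw [mixedBasis_apply, ← mixedMonomial_add, ← mixedBasis_apply, restrictedProjection,
      Module.Basis.constr_basis, if_neg]
    intro h
    have := h i
    simp at this
  | zero => simp
  | add u v hu hv => rw [add_mul, map_add, hu, hv, add_zero]
  | smul c u hu => rw [smul_mul_assoc, map_smul, hu, smul_zero]

theorem restrictedProjection_of_mem {u : UniversalEnvelopingAlgebra k L}
    (hu : u ∈ pDefectIdeal k p b) : restrictedProjection k p b u = 0 := by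
  -- The left factor `v` is carried along so that induction passes through left multiples.
  suffices H : ∀ v, restrictedProjection k p b (v * u) = 0 by simpa using H 1
  induction hu using Submodule.span_induction with
  | mem x hx =>
    obtain ⟨i, rfl⟩ := hx
    exact fun v => restrictedProjection_mul k p b v i
  | zero => simp
  | add x y _ _ hx hy => intro v; rw [mul_add, map_add, hx, hy, add_zero]
  | smul a x _ hx => intro v; rw [smul_eq_mul, ← mul_assoc]; exact hx _

theorem mk_pDefect (x : L) :
    RingQuot.mkAlgHom k (RestrictedEnvelopingAlgebra.Rel k p L) (pDefect k p x) = 0 := by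
  rw [pDefect, map_sub, sub_eq_zero]
  exact RingQuot.mkAlgHom_rel k (RestrictedEnvelopingAlgebra.Rel.pow x)

theorem mk_orderedMonomial (α : Multiset I) :
    RingQuot.mkAlgHom k (RestrictedEnvelopingAlgebra.Rel k p L)
      (orderedMonomial (fun i => UniversalEnvelopingAlgebra.ι k (b i)) α) =
        orderedMonomial (fun i => restrictedι k p (b i)) α :=
  map_orderedMonomial
    (RingQuot.mkAlgHom k (RestrictedEnvelopingAlgebra.Rel k p L)).toMonoidHom _ α

/-- The Poincaré–Birkhoff–Witt theorem for restricted Lie algebras: the restricted enveloping algebra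
has a basis of ordered monomials with exponents less than `p`. -/
def restrictedPbwBasis : Module.Basis {α : Multiset I // ∀ i, α.count i < p} k
    (RestrictedEnvelopingAlgebra k p L) :=
  Module.Basis.mk (v := fun α => orderedMonomial (fun i => restrictedι k p (b i)) α.1)
    (by
      rw [linearIndependent_iff]
      intro c hc
      -- A linear relation in the quotient lifts to a combination of mixed monomials in the ideal;
      -- the projection kills the ideal and reads off the coefficients.
      have h1 : RingQuot.mkAlgHom k (RestrictedEnvelopingAlgebra.Rel k p L)
          (Finsupp.linearCombination k (fun α : {α : Multiset I // ∀ i, α.count i < p} =>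
            mixedMonomial k p b α.1) c) = 0 := by
        rw [← hc, Finsupp.linearCombination_apply, Finsupp.linearCombination_apply, map_finsuppSum]
        refine Finsupp.sum_congr fun α _ => ?_
        rw [map_smul, mixedMonomial_of_lt k p b α.2, mk_orderedMonomial]
      have h2 := restrictedProjection_of_mem k p b (mem_pDefectIdeal_of_mk_eq_zero k p b h1)
      have h3 : Finsupp.mapDomain Subtype.val c = 0 := by
        rw [← h2, Finsupp.linearCombination_apply, map_finsuppSum, Finsupp.mapDomain]
        refine Finsupp.sum_congr fun α _ => ?_
        rw [map_smul, restrictedProjection_of_lt k p b α.2, Finsupp.smul_single_one]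
      exact Finsupp.mapDomain_injective Subtype.val_injective (by rw [h3, Finsupp.mapDomain_zero]))
    (by
      rintro u -
      obtain ⟨u, rfl⟩ := RingQuot.mkAlgHom_surjective k _ u
      induction u using basis_induction (mixedBasis k p b) with
      | zero => rw [map_zero]; exact zero_mem _
      | add u v hu hv => rw [map_add]; exact add_mem hu hv
      | smul c u hu => rw [map_smul]; exact Submodule.smul_mem _ _ hu
      | mem α =>
        rw [mixedBasis_apply]
        by_cases h : ∀ i, α.count i < p
        · rw [mixedMonomial_of_lt k p b h, mk_orderedMonomial]
          exact Submodule.subset_span ⟨⟨α, h⟩, rfl⟩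
        -- An exponent at least `p` yields a factor `pDefect k p (b i)`, which vanishes in the
        -- quotient. So restricted monomials span.
        · push Not at h
          obtain ⟨i, hi⟩ := h
          have h1 : p • {i} ≤ α := by
            rw [Multiset.le_iff_count]
            intro j
            rw [Multiset.count_nsmul, Multiset.count_singleton]
            split_ifs with hj
            · subst hj; simpa using hi
            · simp
          obtain ⟨β, rfl⟩ := Multiset.le_iff_exists_add.1 h1
          rw [mixedMonomial_add, map_mul, mk_pDefect, mul_zero]
          exact zero_mem _)

theorem restrictedPbwBasis_apply (α : {α : Multiset I // ∀ i, α.count i < p}) :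
    restrictedPbwBasis k p b α = orderedMonomial (fun i => restrictedι k p (b i)) α.1 := by
  rw [restrictedPbwBasis, Module.Basis.mk_apply]

end RestrictedPBW

/-! ### Primitive elements of enveloping algebras -/

section Primitive

variable {k : Type*} [Field k] {H : Type*} [Ring H] [Algebra k H] {I : Type*} [LinearOrder I]
  (e : I → H)

/-- Each new factor `e i` is least, so the left tensor factors stay ordered without straightening.
Their exponents stay below `α`, hence inside any set of exponents closed downwards. -/
theorem comul_orderedMonomial_mem (Δ : H →ₐ[k] H ⊗[k] H)
    (hΔ : ∀ i, Δ (e i) = e i ⊗ₜ 1 + 1 ⊗ₜ e i) (α : Multiset I) :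
    Δ (orderedMonomial e α) ∈
      Submodule.span k {t | ∃ β ≤ α, ∃ h, t = orderedMonomial e β ⊗ₜ[k] h} := by
  induction α using multiset_min_induction with
  | zero =>
    rw [orderedMonomial_zero, map_one]
    exact Submodule.subset_span ⟨0, le_rfl, 1, by rw [orderedMonomial_zero]; rfl⟩
  | cons i α hi ih =>
    rw [orderedMonomial_cons _ hi, map_mul, hΔ]
    generalize Δ (orderedMonomial e α) = t at ih ⊢
    induction ih using Submodule.span_induction with
    | mem t ht =>
      obtain ⟨β, hβ, h, rfl⟩ := ht
      rw [add_mul, Algebra.TensorProduct.tmul_mul_tmul, Algebra.TensorProduct.tmul_mul_tmul,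
        one_mul, one_mul,
        ← orderedMonomial_cons _ fun j hj => hi j (Multiset.mem_of_le hβ hj)]
      exact add_mem
        (Submodule.subset_span ⟨_, (Multiset.cons_le_cons_iff i).2 hβ, _, rfl⟩)
        (Submodule.subset_span ⟨_, hβ.trans (Multiset.le_cons_self α i), _, rfl⟩)
    | zero => rw [mul_zero]; exact zero_mem _
    | add s t _ _ hs ht => rw [mul_add]; exact add_mem hs ht
    | smul c s _ hs => rw [mul_smul_comm]; exact Submodule.smul_mem _ _ hs

variable {e} {S : Set (Multiset I)} (B : Module.Basis S k H)

open Classical in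
/-- The linear form that takes the coefficient of `e i`. -/
def linearCoeff (i : I) : H →ₗ[k] k :=
  B.constr k fun α => if α.1 = {i} then 1 else 0

theorem linearCoeff_orderedMonomial (hB : ∀ α, B α = orderedMonomial e α.1) (i : I)
    {α : Multiset I} (hα : α ∈ S) :
    linearCoeff B i (orderedMonomial e α) = if α = {i} then 1 else 0 := by
  rw [← hB ⟨α, hα⟩, linearCoeff, Module.Basis.constr_basis]

/-- The contraction of the comultiplication with the linear form `linearCoeff B i`. -/
def contraction (Δ : H →ₐ[k] H ⊗[k] H) (i : I) : H →ₗ[k] H :=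
  (TensorProduct.lid k H).toLinearMap ∘ₗ LinearMap.rTensor H (linearCoeff B i) ∘ₗ Δ.toLinearMap

/-- The contraction is the partial derivative with respect to `e i`: from `Δ (e j * m) = (e j ⊗ 1) *
Δ m + (1 ⊗ e j) * Δ m` it obeys a Leibniz rule for a least factor `e j`. -/
theorem contraction_orderedMonomial (hB : ∀ α, B α = orderedMonomial e α.1) (h0 : 0 ∈ S)
    (hS : ∀ α ∈ S, ∀ β ≤ α, β ∈ S) (Δ : H →ₐ[k] H ⊗[k] H)
    (hΔ : ∀ i, Δ (e i) = e i ⊗ₜ 1 + 1 ⊗ₜ e i) (ε : H →ₐ[k] k) (hε : ∀ i, ε (e i) = 0) (i : I)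
    {α : Multiset I} (hα : α ∈ S) :
    contraction B Δ i (orderedMonomial e α) =
      (α.count i : k) • orderedMonomial e (α.erase i) := by
  induction α using multiset_min_induction with
  | zero =>
    have := linearCoeff_orderedMonomial B hB i h0
    rw [orderedMonomial_zero] at this
    simp [contraction, orderedMonomial_zero, Algebra.TensorProduct.one_def, this]
  | cons j α hj ih =>
    have hα' := hS _ hα _ (Multiset.le_cons_self α j)
    -- the counit is neutral for the comultiplication
    have hcounit : TensorProduct.lid k H (LinearMap.rTensor H ε.toLinearMap
        (Δ (orderedMonomial e α))) = orderedMonomial e α := by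
      let f : H →ₐ[k] H := (Algebra.TensorProduct.lid k H).toAlgHom.comp
        ((Algebra.TensorProduct.map ε (AlgHom.id k H)).comp Δ)
      have hf : ∀ i, f (e i) = e i := by
        intro i
        simp [f, hΔ, hε]
      have := map_orderedMonomial f.toMonoidHom e α
      change f (orderedMonomial e α) = orderedMonomial (fun i => f (e i)) α at this
      simp only [hf] at this
      exact this
    -- For `β ≤ α` the product of `e j` and the monomial `β` is again a basis monomial; its
    -- coefficient of `e i` is `1` exactly when `j = i` and `β = 0`. For `j = i` the form is thus
    -- `ε` on the monomial `β`, and counitality returns the monomial `α`.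
    have hfirst : TensorProduct.lid k H (LinearMap.rTensor H (linearCoeff B i)
        ((e j ⊗ₜ 1) * Δ (orderedMonomial e α))) = if j = i then orderedMonomial e α else 0 := by
      have ht := comul_orderedMonomial_mem e Δ hΔ α
      generalize Δ (orderedMonomial e α) = t at ht hcounit ⊢
      rw [← hcounit]
      clear hcounit
      induction ht using Submodule.span_induction with
      | mem t ht =>
        obtain ⟨β, hβ, h, rfl⟩ := ht
        have h1 : j ::ₘ β ∈ S := hS _ hα _ ((Multiset.cons_le_cons_iff j).2 hβ)
        have h2 := linearCoeff_orderedMonomial B hB i h1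
        have hβj : ∀ m ∈ β, j ≤ m := fun m hm => hj m (Multiset.mem_of_le hβ hm)
        rw [Algebra.TensorProduct.tmul_mul_tmul, one_mul, ← orderedMonomial_cons _ hβj,
          LinearMap.rTensor_tmul, h2, LinearMap.rTensor_tmul, TensorProduct.lid_tmul,
          TensorProduct.lid_tmul]
        have h3 : ε (orderedMonomial e β) = if β = 0 then 1 else 0 := by
          induction β using multiset_min_induction with
          | zero => simp [orderedMonomial_zero]
          | cons m β hm _ => simp [orderedMonomial_cons _ hm, hε]
        have h4 : j ::ₘ β = {i} ↔ j = i ∧ β = 0 := by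
          constructor
          · intro h
            have hc := congrArg Multiset.card h
            simp only [Multiset.card_cons, Multiset.card_singleton, Nat.add_eq_right,
              Multiset.card_eq_zero] at hc
            subst hc
            simpa using h
          · rintro ⟨rfl, rfl⟩
            rfl
        simp only [AlgHom.toLinearMap_apply, h3, h4]
        by_cases hji : j = i <;> by_cases hb : β = 0 <;> simp [hji, hb]
      | zero => simp
      | add s t _ _ hs ht =>
        rw [mul_add, map_add, map_add, hs, ht, map_add, map_add]
        split_ifs <;> simp
      | smul c s _ hs =>
        rw [mul_smul_comm, map_smul, map_smul, hs, map_smul, map_smul]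
        split_ifs <;> simp
    have hsecond : ∀ t : H ⊗[k] H, TensorProduct.lid k H (LinearMap.rTensor H (linearCoeff B i)
        ((1 ⊗ₜ e j) * t)) = e j * TensorProduct.lid k H (LinearMap.rTensor H (linearCoeff B i) t) := by
      intro t
      induction t using TensorProduct.induction_on with
      | zero => simp
      | tmul x y => simp
      | add s t hs ht => rw [mul_add, map_add, map_add, hs, ht, map_add, map_add, mul_add]
    have hstep : contraction B Δ i (orderedMonomial e (j ::ₘ α)) =
        (if j = i then orderedMonomial e α else 0) +
          e j * contraction B Δ i (orderedMonomial e α) := by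
      rw [orderedMonomial_cons _ hj]
      simp only [contraction, LinearMap.comp_apply, AlgHom.toLinearMap_apply,
        LinearEquiv.coe_coe] at *
      rw [map_mul, hΔ, add_mul, map_add, map_add, hfirst, hsecond]
    rw [hstep, ih hα', mul_smul_comm]
    by_cases hji : j = i
    · subst hji
      by_cases hmem : j ∈ α
      · rw [← orderedMonomial_cons _ fun m hm => hj m (Multiset.mem_of_mem_erase hm),
          Multiset.cons_erase hmem]
        simp [add_smul, add_comm]
      · simp [Multiset.count_eq_zero_of_notMem hmem]
    · rw [if_neg hji, zero_add, ← orderedMonomial_cons _ fun m hm =>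
        hj m (Multiset.mem_of_mem_erase hm), Multiset.erase_cons_tail _ hji,
        Multiset.count_cons_of_ne (Ne.symm hji)]

/-- If the ordered monomials in primitive elements `e i`, with exponents in a suitable set, form a
basis, then every primitive element is a linear combination of the elements `e i`. -/
theorem mem_span_of_primitive (hB : ∀ α, B α = orderedMonomial e α.1) (h0 : 0 ∈ S)
    (hS : ∀ α ∈ S, ∀ β ≤ α, β ∈ S) (hcount : ∀ α ∈ S, ∀ i ∈ α, (α.count i : k) ≠ 0)
    (Δ : H →ₐ[k] H ⊗[k] H) (hΔ : ∀ i, Δ (e i) = e i ⊗ₜ 1 + 1 ⊗ₜ e i)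
    (ε : H →ₐ[k] k) (hε : ∀ i, ε (e i) = 0) {a : H} (ha : Δ a = a ⊗ₜ 1 + 1 ⊗ₜ a)
    (ha0 : ε a = 0) : a ∈ Submodule.span k (Set.range e) := by
  have hone : B ⟨0, h0⟩ = 1 := by rw [hB, orderedMonomial_zero]
  have hcoeff0 : B.repr a ⟨0, h0⟩ = 0 := by
    have h : B.coord ⟨0, h0⟩ = ε.toLinearMap := by
      refine B.ext fun α => ?_
      obtain ⟨α, hα⟩ := α
      rw [Module.Basis.coord_apply, Module.Basis.repr_self, hB, AlgHom.toLinearMap_apply]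
      induction α using multiset_min_induction with
      | zero => simp [orderedMonomial_zero]
      | cons m β hm _ =>
        rw [Finsupp.single_eq_of_ne (by simp [Subtype.ext_iff])]
        simp [orderedMonomial_cons _ hm, hε]
    rw [← Module.Basis.coord_apply, h]
    exact ha0
  have hcoeff : ∀ α : S, ∀ i ∈ α.1, α.1 ≠ {i} → B.repr a α = 0 := by
    rintro ⟨α, hα⟩ i hi hαi
    have hα' := hS α hα _ (Multiset.erase_le i α)
    -- Among monomials containing `i`, only `α` has derivative proportional to `α.erase i`; the
    -- others have derivative zero.
    have h1 : B.coord ⟨α.erase i, hα'⟩ ∘ₗ contraction B Δ i =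
        (α.count i : k) • B.coord ⟨α, hα⟩ := by
      refine B.ext fun β => ?_
      obtain ⟨β, hβ⟩ := β
      have hβ' := hS β hβ _ (Multiset.erase_le i β)
      rw [LinearMap.comp_apply, hB,
        contraction_orderedMonomial B hB h0 hS Δ hΔ ε hε i hβ, map_smul, ← hB ⟨β, hβ⟩,
        ← hB ⟨β.erase i, hβ'⟩]
      simp only [Module.Basis.coord_apply, Module.Basis.repr_self, LinearMap.smul_apply,
        Finsupp.single_apply, Subtype.mk.injEq]
      by_cases hmem : i ∈ β
      · have hiff : β.erase i = α.erase i ↔ β = α := by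
          constructor
          · intro h
            rw [← Multiset.cons_erase hmem, h, Multiset.cons_erase hi]
          · rintro rfl; rfl
        simp only [hiff]
        split_ifs with h
        · rw [h]
        · simp
      · have hne : β ≠ α := by rintro rfl; exact hmem hi
        simp [Multiset.count_eq_zero_of_notMem hmem, hne]
    -- Primitivity makes the derivative of `a` a scalar, since the form vanishes on `1`. A scalar
    -- has no component at `α.erase i`, which is nonempty when `α ≠ {i}`, and the factor `α.count i`
    -- can be cancelled.
    have h2 : contraction B Δ i a = linearCoeff B i a • (1 : H) := by
      have h3 : linearCoeff B i 1 = 0 := by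
        have := linearCoeff_orderedMonomial B hB i h0
        rw [orderedMonomial_zero] at this
        simp [this]
      simp [contraction, ha, h3]
    have h3 := congrArg (fun f => f a) h1
    simp only [LinearMap.comp_apply, h2, map_smul, LinearMap.smul_apply] at h3
    rw [← hone, Module.Basis.coord_apply, Module.Basis.repr_self, Finsupp.single_eq_of_ne,
      smul_zero, Module.Basis.coord_apply] at h3
    · exact (smul_eq_zero.1 h3.symm).resolve_left (hcount α hα i hi)
    · intro h
      rw [Subtype.mk.injEq] at h
      exact hαi (by rw [← Multiset.cons_erase hi, h]; rfl)
  rw [← B.linearCombination_repr a, Finsupp.linearCombination_apply]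
  refine Submodule.sum_mem _ fun α hα => ?_
  rw [Finsupp.mem_support_iff] at hα
  refine Submodule.smul_mem _ _ (Submodule.subset_span ?_)
  obtain ⟨α, hαS⟩ := α
  obtain rfl | ⟨i, hi⟩ := Multiset.empty_or_exists_mem α
  · exact absurd hcoeff0 hα
  · have : α = {i} := by
      by_contra h
      exact hα (hcoeff ⟨α, hαS⟩ i hi h)
    subst this
    exact ⟨i, by rw [hB, orderedMonomial_singleton]⟩

theorem injective_of_basis {V : Type*} [AddCommGroup V] [Module k V] (b : Module.Basis I k V)
    (f : V →ₗ[k] H) (h : LinearIndependent k fun i => f (b i)) : Function.Injective f := by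
  rw [injective_iff_map_eq_zero]
  intro x hx
  rw [← b.linearCombination_repr x, Finsupp.linearCombination_apply, map_finsuppSum] at hx
  simp only [map_smul] at hx
  rw [← b.repr.map_eq_zero_iff]
  exact linearIndependent_iff.1 h _ hx

/-- The elements `e i` are linearly independent if the ordered monomials are. -/
theorem linearIndependent_of_orderedMonomial (hB : ∀ α, B α = orderedMonomial e α.1)
    (hS : ∀ i, {i} ∈ S) : LinearIndependent k e := by
  have := B.linearIndependent.comp (fun i => (⟨{i}, hS i⟩ : S)) fun i j h => by
    simpa using h
  convert this using 1
  ext i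
  simp [hB, orderedMonomial_singleton]

end Primitive

/-! ### Comultiplications and Friedrichs' criterion for `U(L)` and `U_p(L)` -/

section Hopf

variable (k : Type*) [Field k] (L : Type*) [LieRing L] [LieAlgebra k L]

theorem counit_ι (x : L) : counit k L (UniversalEnvelopingAlgebra.ι k x) = 0 := by
  rw [counit, UniversalEnvelopingAlgebra.lift_ι_apply]
  rfl

/-- The map `x ↦ f x ⊗ 1 + 1 ⊗ f x`. -/
def diagonalHom {k : Type*} [Field k] {L : Type*} [LieRing L] [LieAlgebra k L] {A B : Type*}
    [Ring A] [Algebra k A] [Ring B] [Algebra k B] (f : L →ₗ⁅k⁆ A) (g : L →ₗ⁅k⁆ B) :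
    L →ₗ⁅k⁆ A ⊗[k] B where
  toFun x := f x ⊗ₜ 1 + 1 ⊗ₜ g x
  map_add' x y := by simp only [map_add, TensorProduct.add_tmul, TensorProduct.tmul_add]; abel
  map_smul' c x := by
    simp only [map_smul, TensorProduct.smul_tmul', TensorProduct.tmul_smul, smul_add,
      RingHom.id_apply]
  map_lie' {x y} := by
    simp only [LieHom.map_lie, LieRing.of_associative_ring_bracket, TensorProduct.sub_tmul,
      TensorProduct.tmul_sub, add_mul, mul_add, Algebra.TensorProduct.tmul_mul_tmul, one_mul,
      mul_one]
    abel

theorem diagonalHom_apply {L A B : Type*} [LieRing L] [LieAlgebra k L]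
    [Ring A] [Algebra k A] [Ring B] [Algebra k B] (f : L →ₗ⁅k⁆ A) (g : L →ₗ⁅k⁆ B) (x : L) :
    diagonalHom f g x = f x ⊗ₜ 1 + 1 ⊗ₜ g x := rfl

/-- The comultiplication of the enveloping algebra. -/
def comul : UniversalEnvelopingAlgebra k L →ₐ[k]
    UniversalEnvelopingAlgebra k L ⊗[k] UniversalEnvelopingAlgebra k L :=
  UniversalEnvelopingAlgebra.lift k
    (diagonalHom (UniversalEnvelopingAlgebra.ι k) (UniversalEnvelopingAlgebra.ι k))

theorem comul_ι (x : L) : comul k L (UniversalEnvelopingAlgebra.ι k x) =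
    UniversalEnvelopingAlgebra.ι k x ⊗ₜ 1 + 1 ⊗ₜ UniversalEnvelopingAlgebra.ι k x := by
  rw [comul, UniversalEnvelopingAlgebra.lift_ι_apply]
  rfl

/-- A basis of a vector space, with linearly ordered indices. -/
theorem exists_linearOrder_basis (V : Type v) [AddCommGroup V] [Module k V] :
    ∃ (I : Type v) (_ : LinearOrder I), Nonempty (Module.Basis I k V) := by
  classical
  exact ⟨_, linearOrderOfSTO WellOrderingRel, ⟨Module.Basis.ofVectorSpace k V⟩⟩

theorem span_range_le_range {I V H : Type*} [AddCommGroup V] [Module k V] [AddCommGroup H]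
    [Module k H] (f : V →ₗ[k] H) (b : I → V) {a : H}
    (ha : a ∈ Submodule.span k (Set.range fun i => f (b i))) : a ∈ Set.range f := by
  have h : Submodule.span k (Set.range fun i => f (b i)) ≤ LinearMap.range f :=
    Submodule.span_le.2 (by rintro _ ⟨i, rfl⟩; exact ⟨b i, rfl⟩)
  exact h ha

/-- The basis elements of `L` are the monomials of degree one in the Poincaré–Birkhoff–Witt basis.
-/
theorem enveloping_ι_injective :
    Function.Injective (UniversalEnvelopingAlgebra.ι k : L → UniversalEnvelopingAlgebra k L) := by
  obtain ⟨I, _, ⟨b⟩⟩ := exists_linearOrder_basis k L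
  have h := linearIndependent_of_orderedMonomial
    (e := fun i => UniversalEnvelopingAlgebra.ι k (b i))
    ((pbwBasis b).reindex (Equiv.Set.univ _).symm) (fun α => by simp [pbwBasis_apply])
    (fun i => trivial)
  exact injective_of_basis b (UniversalEnvelopingAlgebra.ι k : L →ₗ⁅k⁆ _).toLinearMap h

/-- The primitive elements of the enveloping algebra in characteristic zero. -/
theorem mem_range_ι_of_primitive [CharZero k] {a : UniversalEnvelopingAlgebra k L}
    (ha : comul k L a = a ⊗ₜ 1 + 1 ⊗ₜ a) (ha0 : counit k L a = 0) :
    a ∈ Set.range (UniversalEnvelopingAlgebra.ι k : L → UniversalEnvelopingAlgebra k L) := by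
  obtain ⟨I, _, ⟨b⟩⟩ := exists_linearOrder_basis k L
  refine span_range_le_range k (UniversalEnvelopingAlgebra.ι k : L →ₗ⁅k⁆ _).toLinearMap b ?_
  refine mem_span_of_primitive (e := fun i => UniversalEnvelopingAlgebra.ι k (b i))
    ((pbwBasis b).reindex (Equiv.Set.univ _).symm) (fun α => by simp [pbwBasis_apply]) trivial
    (fun _ _ _ _ => trivial) (fun α _ i hi => ?_) (comul k L) (fun i => comul_ι k L _)
    (counit k L) (fun i => counit_ι k L _) ha ha0
  rw [Nat.cast_ne_zero]
  exact Multiset.count_ne_zero.2 hi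

variable (p : ℕ) [hp : Fact p.Prime] [CharP k p] [RestrictedLieAlgebra k p L]

variable {k p L} in
/-- The universal property of the restricted enveloping algebra. -/
def restrictedLift {A : Type*} [Ring A] [Algebra k A] (f : L →ₗ⁅k⁆ A)
    (hf : ∀ x, f (pMap k p x) = f x ^ p) : RestrictedEnvelopingAlgebra k p L →ₐ[k] A :=
  RingQuot.liftAlgHom k ⟨UniversalEnvelopingAlgebra.lift k f, by
    rintro _ _ ⟨x⟩
    rw [map_pow, UniversalEnvelopingAlgebra.lift_ι_apply, UniversalEnvelopingAlgebra.lift_ι_apply,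
      hf]⟩

variable {k p L} in
theorem restrictedLift_ι {A : Type*} [Ring A] [Algebra k A] (f : L →ₗ⁅k⁆ A)
    (hf : ∀ x, f (pMap k p x) = f x ^ p) (x : L) :
    restrictedLift f hf (restrictedι k p x) = f x :=
  (RingQuot.liftAlgHom_mkAlgHom_apply k _ _ _).trans (UniversalEnvelopingAlgebra.lift_ι_apply k f x)

theorem restrictedι_pMap (x : L) : restrictedι k p (pMap k p x) = restrictedι k p x ^ p := by
  have := RingQuot.mkAlgHom_rel k (RestrictedEnvelopingAlgebra.Rel.pow (k := k) (p := p) x)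
  rw [map_pow] at this
  exact this.symm

/-- The canonical map to the restricted enveloping algebra, as a morphism of Lie algebras. -/
def restrictedιHom : L →ₗ⁅k⁆ RestrictedEnvelopingAlgebra k p L where
  __ := restrictedι k p
  map_lie' {x y} := by
    change RingQuot.mkAlgHom k _ (UniversalEnvelopingAlgebra.ι k ⁅x, y⁆) = _
    rw [LieHom.map_lie, LieRing.of_associative_ring_bracket, map_sub, map_mul, map_mul]
    rfl

theorem restrictedιHom_apply (x : L) : restrictedιHom k L p x = restrictedι k p x := rfl

theorem restrictedCounit_ι (x : L) : restrictedCounit k p L (restrictedι k p x) = 0 :=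
  (RingQuot.liftAlgHom_mkAlgHom_apply k _ _ _).trans (counit_ι k L x)

/-- The two summands commute, so the `p`-th power is additive on them. This is why the
comultiplication descends to the restricted enveloping algebra. -/
theorem diagonalHom_pow {A B : Type*} [Ring A] [Algebra k A] [Ring B] [Algebra k B] (x : A) (y : B) :
    (x ⊗ₜ[k] (1 : B) + (1 : A) ⊗ₜ[k] y) ^ p = (x ^ p) ⊗ₜ 1 + 1 ⊗ₜ (y ^ p) := by
  have h : Commute (x ⊗ₜ[k] (1 : B)) ((1 : A) ⊗ₜ[k] y) := by
    simp [commute_iff_eq, Algebra.TensorProduct.tmul_mul_tmul]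
  rw [add_pow_prime_of_commute k p h, Algebra.TensorProduct.tmul_pow,
    Algebra.TensorProduct.tmul_pow, one_pow, one_pow]

/-- The comultiplication of the restricted enveloping algebra. -/
def restrictedComul : RestrictedEnvelopingAlgebra k p L →ₐ[k]
    RestrictedEnvelopingAlgebra k p L ⊗[k] RestrictedEnvelopingAlgebra k p L :=
  restrictedLift (diagonalHom (restrictedιHom k L p) (restrictedιHom k L p)) fun x => by
    rw [diagonalHom_apply, diagonalHom_apply, diagonalHom_pow, restrictedιHom_apply,
      restrictedιHom_apply, restrictedι_pMap]

theorem restrictedComul_ι (x : L) : restrictedComul k L p (restrictedι k p x) =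
    restrictedι k p x ⊗ₜ 1 + 1 ⊗ₜ restrictedι k p x := by
  rw [restrictedComul, restrictedLift_ι]
  rfl

theorem restrictedι_injective :
    Function.Injective (restrictedι k p : L →ₗ[k] RestrictedEnvelopingAlgebra k p L) := by
  obtain ⟨I, _, ⟨b⟩⟩ := exists_linearOrder_basis k L
  refine injective_of_basis b _ (linearIndependent_of_orderedMonomial
    (S := {α : Multiset I | ∀ i, α.count i < p})
    (restrictedPbwBasis k p b) (restrictedPbwBasis_apply k p b) fun i j => ?_)
  exact (Multiset.count_le_card _ _).trans_lt (by simpa using hp.out.one_lt)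

/-- The primitive elements of the restricted enveloping algebra. -/
theorem mem_range_restrictedι_of_primitive {a : RestrictedEnvelopingAlgebra k p L}
    (ha : restrictedComul k L p a = a ⊗ₜ 1 + 1 ⊗ₜ a) (ha0 : restrictedCounit k p L a = 0) :
    a ∈ Set.range (restrictedι k p : L →ₗ[k] RestrictedEnvelopingAlgebra k p L) := by
  obtain ⟨I, _, ⟨b⟩⟩ := exists_linearOrder_basis k L
  refine span_range_le_range k (restrictedι k p) b ?_
  refine mem_span_of_primitive (S := {α : Multiset I | ∀ i, α.count i < p})
    (restrictedPbwBasis k p b) (restrictedPbwBasis_apply k p b) (fun i => by simpa using hp.out.pos)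
    (fun α hα β hβ i => (Multiset.count_le_of_le i hβ).trans_lt (hα i)) (fun α hα i hi h => ?_)
    (restrictedComul k L p) (fun i => restrictedComul_ι k L p _)
    (restrictedCounit k p L) (fun i => restrictedCounit_ι k L p _) ha ha0
  -- A positive multiplicity below `p` is not divisible by `p`.
  rw [CharP.cast_eq_zero_iff k p] at h
  exact absurd (Nat.le_of_dvd (Multiset.count_pos.2 hi) h) (not_le.2 (hα i))

end Hopf

/-! ### Universal properties -/

section Free

variable {k : Type*} [Field k] {L : Type*} [LieRing L] [LieAlgebra k L]
  {L' : Type*} [LieRing L'] [LieAlgebra k L']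

theorem freeAdjoinIdeal_le_ker (f : L →ₗ⁅k⁆ L') (y : L') :
    freeAdjoinIdeal k L ≤ (FreeLieAlgebra.lift k fun o : Option L => o.elim y f).ker := by
  rw [freeAdjoinIdeal, LieSubmodule.lieSpan_le]
  rintro _ ((⟨a, b, rfl⟩ | ⟨c, a, rfl⟩) | ⟨a, b, rfl⟩) <;>
    simp [LieHom.mem_ker, FreeLieAlgebra.lift_of_apply]

/-- The morphism from `⟨L, x⟩` that extends `f` and sends `x` to `y`. -/
def FreeAdjoin.lift (f : L →ₗ⁅k⁆ L') (y : L') : FreeAdjoin k L →ₗ⁅k⁆ L' where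
  __ := (freeAdjoinIdeal k L).toSubmodule.liftQ
    (FreeLieAlgebra.lift k fun o : Option L => o.elim y f : _ →ₗ⁅k⁆ L').toLinearMap
    (freeAdjoinIdeal_le_ker f y)
  map_lie' {s t} := by
    obtain ⟨s, rfl⟩ := LieSubmodule.Quotient.surjective_mk' _ s
    obtain ⟨t, rfl⟩ := LieSubmodule.Quotient.surjective_mk' _ t
    exact LieHom.map_lie (FreeLieAlgebra.lift k fun o : Option L => o.elim y f) s t

theorem FreeAdjoin.lift_incl (f : L →ₗ⁅k⁆ L') (y : L') (a : L) :
    FreeAdjoin.lift f y (FreeAdjoin.incl k L a) = f a :=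
  FreeLieAlgebra.lift_of_apply (R := k) (fun o : Option L => o.elim y f) (some a)

theorem FreeAdjoin.lift_var (f : L →ₗ⁅k⁆ L') (y : L') :
    FreeAdjoin.lift f y (FreeAdjoin.var k L) = y :=
  FreeLieAlgebra.lift_of_apply (R := k) (fun o : Option L => o.elim y f) none

theorem FreeAdjoin.hom_ext {f g : FreeAdjoin k L →ₗ⁅k⁆ L'}
    (h : ∀ a, f (FreeAdjoin.incl k L a) = g (FreeAdjoin.incl k L a))
    (hvar : f (FreeAdjoin.var k L) = g (FreeAdjoin.var k L)) : f = g := by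
  let q : FreeLieAlgebra k (Option L) →ₗ⁅k⁆ FreeAdjoin k L :=
    { LieSubmodule.Quotient.mk' (freeAdjoinIdeal k L) with
      map_lie' := fun {s t} => LieSubmodule.Quotient.mk_bracket _ s t }
  have hq : f.comp q = g.comp q := by
    refine FreeLieAlgebra.hom_ext fun o => ?_
    cases o with
    | none => exact hvar
    | some a => exact h a
  ext z
  obtain ⟨z, rfl⟩ := LieSubmodule.Quotient.surjective_mk' _ z
  exact congrArg (fun F => F z) hq

end Free

/-! ### The universal property of the restricted `⟨L, x⟩` -/

section RestrictedFree

variable {k : Type*} [Field k] {p : ℕ} {L : Type*} [LieRing L] [LieAlgebra k L]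
  [RestrictedLieAlgebra k p L] {L' : Type*} [LieRing L'] [LieAlgebra k L']
  [RestrictedLieAlgebra k p L']

/-- The value of a formal expression in a restricted Lie algebra. -/
def RestrictedPre.eval (f : RestrictedLieHom k p L L') (y : L') : RestrictedPre k L → L'
  | of a => f.toLieHom a
  | var => y
  | zero => 0
  | add s t => eval f y s + eval f y t
  | smul c s => c • eval f y s
  | lie s t => ⁅eval f y s, eval f y t⁆
  | pth s => pMap k p (eval f y s)

namespace RestrictedPre

variable (f : RestrictedLieHom k p L L') (y : L')

theorem eval_zero : eval f y (0 : RestrictedPre k L) = 0 := rfl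

theorem eval_add (s t : RestrictedPre k L) : eval f y (s + t) = eval f y s + eval f y t := rfl

theorem eval_smul (c : k) (s : RestrictedPre k L) : eval f y (c • s) = c • eval f y s := rfl

theorem eval_lie (s t : RestrictedPre k L) : eval f y ⁅s, t⁆ = ⁅eval f y s, eval f y t⁆ := rfl

theorem eval_pth (s : RestrictedPre k L) : eval f y (pth s) = pMap k p (eval f y s) := rfl

theorem eval_of (a : L) : eval f y (of a) = f.toLieHom a := rfl

theorem eval_adPowCoeff (s t : RestrictedPre k L) (n j : ℕ) :
    eval f y (adPowCoeff s t n j) = adPowCoeff (eval f y s) (eval f y t) n j := by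
  induction n generalizing j with
  | zero => cases j <;> rfl
  | succ n ih => cases j <;> simp only [adPowCoeff, eval_lie, eval_add, ih]

theorem eval_jacobsonSum (s t : RestrictedPre k L) (n : ℕ) :
    eval f y (jacobsonSum k p s t n) = jacobsonSum k p (eval f y s) (eval f y t) n := by
  induction n with
  | zero => rfl
  | succ n ih => simp only [jacobsonSum, eval_add, eval_smul, eval_adPowCoeff, ih]

theorem eval_iterate_lie (s t : RestrictedPre k L) (n : ℕ) :
    eval f y ((fun r : RestrictedPre k L => ⁅s, r⁆)^[n] t) =
      (LieAlgebra.ad k L' (eval f y s) ^ n) (eval f y t) := by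
  induction n with
  | zero => rfl
  | succ n ih =>
    rw [Function.iterate_succ_apply', pow_succ', Module.End.mul_apply, ← ih]
    rfl

/-- Each imposed identity is an axiom valid in `L'` or expresses that `f` is a morphism; the
congruence rules follow by induction. -/
theorem eval_eq_of_rel {s t : RestrictedPre k L} (h : Rel k L p s t) :
    eval f y s = eval f y t := by
  induction h with
  | add_assoc r s t => simp only [eval_add, _root_.add_assoc]
  | add_comm s t => simp only [eval_add, _root_.add_comm]
  | zero_add s => simp only [eval_add, eval_zero, _root_.zero_add]
  | neg_add s => simp [eval_add, eval_smul, eval_zero]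
  | one_smul s => simp only [eval_smul, _root_.one_smul]
  | mul_smul c d s => simp only [eval_smul, SemigroupAction.mul_smul]
  | smul_add c s t => simp only [eval_smul, eval_add, _root_.smul_add]
  | add_smul c d s => simp only [eval_smul, eval_add, _root_.add_smul]
  | add_lie r s t => simp only [eval_lie, eval_add, _root_.add_lie]
  | lie_add r s t => simp only [eval_lie, eval_add, _root_.lie_add]
  | lie_smul c s t => simp only [eval_lie, eval_smul, _root_.lie_smul]
  | lie_self s => simp only [eval_lie, eval_zero, _root_.lie_self]
  | leibniz_lie r s t => simp only [eval_lie, eval_add]; exact _root_.leibniz_lie _ _ _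
  | pth_smul c s =>
    simp only [eval_pth, eval_smul]
    exact RestrictedLieAlgebra.pMap_smul c _
  | pth_add s t =>
    simp only [eval_pth, eval_add, eval_jacobsonSum, jacobsonSum_eq]
    exact RestrictedLieAlgebra.pMap_add _ _
  | pth_lie s t =>
    rw [eval_iterate_lie, eval_lie, eval_pth, ← LieAlgebra.ad_apply k]
    exact LinearMap.congr_fun (RestrictedLieAlgebra.ad_pMap (k := k) (p := p) (eval f y s)) _
  | of_add a b => simp only [eval_of, eval_add, map_add]
  | of_smul c a => simp only [eval_of, eval_smul, map_smul]
  | of_lie a b => simp only [eval_of, eval_lie, LieHom.map_lie]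
  | of_pth a => simp only [eval_of, eval_pth, f.map_pMap]
  | add_left r _ ih => simp only [eval_add, ih]
  | add_right r _ ih => simp only [eval_add, ih]
  | smul c _ ih => simp only [eval_smul, ih]
  | lie_left r _ ih => simp only [eval_lie, ih]
  | lie_right r _ ih => simp only [eval_lie, ih]
  | pth_congr _ ih => simp only [eval_pth, ih]

end RestrictedPre

namespace RestrictedFreeAdjoin

/-- The morphism from `⟨L, x⟩` that extends `f` and sends `x` to `y`. -/
def lift (f : RestrictedLieHom k p L L') (y : L') :
    RestrictedLieHom k p (RestrictedFreeAdjoin k p L) L' where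
  toLieHom :=
    { toFun := Quot.lift (RestrictedPre.eval f y) fun _ _ h => RestrictedPre.eval_eq_of_rel f y h
      map_add' := by rintro ⟨s⟩ ⟨t⟩; rfl
      map_smul' := by rintro c ⟨s⟩; rfl
      map_lie' := by rintro ⟨s⟩ ⟨t⟩; rfl }
  map_pMap := by rintro ⟨s⟩; rfl

/-- Structural induction on formal expressions: morphisms preserve every operation from which these
are built. -/
theorem hom_ext {f g : RestrictedLieHom k p (RestrictedFreeAdjoin k p L) L'}
    (h : ∀ a, f.toLieHom ((incl k p L).toLieHom a) = g.toLieHom ((incl k p L).toLieHom a))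
    (hvar : f.toLieHom (var k p L) = g.toLieHom (var k p L))
    (z : RestrictedFreeAdjoin k p L) : f.toLieHom z = g.toLieHom z := by
  obtain ⟨s⟩ := z
  change f.toLieHom (mk k p L s) = g.toLieHom (mk k p L s)
  induction s with
  | of a => exact h a
  | var => exact hvar
  | zero => exact (map_zero f.toLieHom).trans (map_zero g.toLieHom).symm
  | add s t hs ht =>
    have e : mk k p L (s.add t) = mk k p L s + mk k p L t := rfl
    rw [e, map_add, map_add, hs, ht]
  | smul c s hs =>
    have e : mk k p L (s.smul c) = c • mk k p L s := rfl
    rw [e, map_smul, map_smul, hs]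
  | lie s t hs ht =>
    have e : mk k p L (s.lie t) = ⁅mk k p L s, mk k p L t⁆ := rfl
    rw [e, LieHom.map_lie, LieHom.map_lie, hs, ht]
  | pth s hs =>
    have e : mk k p L s.pth = pMap k p (mk k p L s) := rfl
    rw [e, f.map_pMap, g.map_pMap, hs]

end RestrictedFreeAdjoin

end RestrictedFree

/-! ### Universally derivative elements are primitive -/

section Matrices

variable {k : Type*} [Field k] {H A : Type*} [Ring H] [Algebra k H] [Ring A] [Algebra k A]

/-- The algebra homomorphism `h ↦ diag(f(h), g(h))`. -/
def diagAlgHom (f g : H →ₐ[k] A) : H →ₐ[k] Matrix (Fin 2) (Fin 2) A :=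
  (Matrix.diagonalAlgHom k).comp (AlgHom.pi ![f, g])

theorem diagAlgHom_apply (f g : H →ₐ[k] A) (h : H) :
    diagAlgHom f g h = !![f h, 0; 0, g h] := by
  ext i j
  fin_cases i <;> fin_cases j <;> simp [diagAlgHom]

/-- The matrix unit in the upper right corner. -/
def cornerUnit (A : Type*) [Ring A] : Matrix (Fin 2) (Fin 2) A := !![0, 1; 0, 0]

/-- The matrix on the right is scalar, and its entry `1 ⊗ h` commutes with all entries from `H ⊗ 1`.
-/
theorem commute_scalar (T : Matrix (Fin 2) (Fin 2) H) (h : A) :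
    Commute ((Algebra.TensorProduct.includeLeft : H →ₐ[k] H ⊗[k] A).mapMatrix T)
      (diagAlgHom Algebra.TensorProduct.includeRight Algebra.TensorProduct.includeRight h) := by
  rw [diagAlgHom_apply]
  ext i j
  fin_cases i <;> fin_cases j <;> simp [Matrix.mul_apply]

/-- The splitting is `diag(Δ a, 1 ⊗ a) = diag(a ⊗ 1, 0) + diag(1 ⊗ a, 1 ⊗ a)`. Applied to elements
of `L`, it starts the comparison of the two matrix representations. -/
theorem diagAlgHom_of_primitive {Δ : H →ₐ[k] H ⊗[k] H} {ε : H →ₐ[k] k} {a : H}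
    (ha : Δ a = a ⊗ₜ 1 + 1 ⊗ₜ a) (ha0 : ε a = 0) :
    diagAlgHom Δ Algebra.TensorProduct.includeRight a =
      (Algebra.TensorProduct.includeLeft : H →ₐ[k] H ⊗[k] H).mapMatrix
        (diagAlgHom (AlgHom.id k H) ((Algebra.ofId k H).comp ε) a) +
      diagAlgHom Algebra.TensorProduct.includeRight Algebra.TensorProduct.includeRight a := by
  ext i j
  fin_cases i <;> fin_cases j <;> simp [diagAlgHom_apply, ha, ha0]

variable (H) in
theorem cornerUnit_eq_add :
    cornerUnit (H ⊗[k] H) =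
      (Algebra.TensorProduct.includeLeft : H →ₐ[k] H ⊗[k] H).mapMatrix (cornerUnit H) +
      diagAlgHom Algebra.TensorProduct.includeRight Algebra.TensorProduct.includeRight 0 := by
  ext i j
  fin_cases i <;> fin_cases j <;> simp [cornerUnit, Algebra.TensorProduct.one_def]

/-- The sum of two morphisms with commuting images. -/
def addCommuting {L : Type*} [LieRing L] [LieAlgebra k L] (f g : L →ₗ⁅k⁆ A)
    (h : ∀ x y, Commute (f x) (g y)) : L →ₗ⁅k⁆ A where
  __ := f.toLinearMap + g.toLinearMap
  map_lie' {x y} := by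
    change f ⁅x, y⁆ + g ⁅x, y⁆ = ⁅f x + g x, f y + g y⁆
    simp only [LieHom.map_lie, LieRing.of_associative_ring_bracket, add_mul, mul_add,
      (h x y).eq, (h y x).eq]
    abel

/-- With `E` the corner unit, `[diag(s, t), E] = (s - t) E`. The upper right entry of `hw` therefore
reads `Δ a - 1 ⊗ a = (a - ε a) ⊗ 1`, as the scalar summand is diagonal. -/
theorem primitive_of_commutator {Hx : Type*} [Ring Hx] [Algebra k Hx]
    {Δ : H →ₐ[k] H ⊗[k] H} {ε : H →ₐ[k] k} {φ : H →ₐ[k] Hx} {X : Hx}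
    {Θ : Hx →ₐ[k] Matrix (Fin 2) (Fin 2) (H ⊗[k] H)} {Ψ : Hx →ₐ[k] Matrix (Fin 2) (Fin 2) H}
    (hΘ : Θ.comp φ = diagAlgHom Δ Algebra.TensorProduct.includeRight)
    (hΘX : Θ X = cornerUnit _)
    (hΨ : Ψ.comp φ = diagAlgHom (AlgHom.id k H) ((Algebra.ofId k H).comp ε))
    (hΨX : Ψ X = cornerUnit _) {a : H} (ha : ε a = 0)
    (hw : ∃ h : H, Θ (φ a * X - X * φ a) =
      (Algebra.TensorProduct.includeLeft : H →ₐ[k] H ⊗[k] H).mapMatrix (Ψ (φ a * X - X * φ a)) +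
        diagAlgHom Algebra.TensorProduct.includeRight Algebra.TensorProduct.includeRight h) :
    Δ a = a ⊗ₜ 1 + 1 ⊗ₜ a := by
  obtain ⟨h, hw⟩ := hw
  have e1 : Θ (φ a) = _ := congrArg (fun F => F a) hΘ
  have e2 : Ψ (φ a) = _ := congrArg (fun F => F a) hΨ
  rw [map_sub, map_mul, map_mul, map_sub, map_mul, map_mul, hΘX, hΨX, e1, e2,
    diagAlgHom_apply, diagAlgHom_apply, diagAlgHom_apply, cornerUnit, cornerUnit] at hw
  have := congrArg (fun M => M 0 1) hw
  simp [ha] at this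
  rw [← this, sub_add_cancel]

end Matrices

/-! ### Universally derivative elements of `U(L)` -/

section PartOne

variable {k : Type*} [Field k] {L : Type*} [LieRing L] [LieAlgebra k L]

theorem envelopingMap_ι {L' : Type*} [LieRing L'] [LieAlgebra k L'] (f : L →ₗ⁅k⁆ L') (x : L) :
    envelopingMap f (UniversalEnvelopingAlgebra.ι k x) = UniversalEnvelopingAlgebra.ι k (f x) := by
  rw [envelopingMap, UniversalEnvelopingAlgebra.lift_ι_apply]
  rfl

theorem enveloping_algHom_ext {A : Type*} [Ring A] [Algebra k A]
    {F G : UniversalEnvelopingAlgebra k L →ₐ[k] A}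
    (h : ∀ x, F (UniversalEnvelopingAlgebra.ι k x) = G (UniversalEnvelopingAlgebra.ι k x)) :
    F = G :=
  UniversalEnvelopingAlgebra.hom_ext k (LieHom.ext h)

theorem comul_eq_of_isUniversallyDerivative {a : UniversalEnvelopingAlgebra k L}
    (ha0 : counit k L a = 0) (ha : IsUniversallyDerivative k L a) :
    comul k L a = a ⊗ₜ 1 + 1 ⊗ₜ a := by
  obtain ⟨w, hw⟩ := ha
  let H := UniversalEnvelopingAlgebra k L
  let ι : L →ₗ⁅k⁆ H := UniversalEnvelopingAlgebra.ι k
  let dΘ : H →ₐ[k] Matrix (Fin 2) (Fin 2) (H ⊗[k] H) :=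
    diagAlgHom (comul k L) Algebra.TensorProduct.includeRight
  let dΨ : H →ₐ[k] Matrix (Fin 2) (Fin 2) H :=
    diagAlgHom (AlgHom.id k _) ((Algebra.ofId k _).comp (counit k L))
  let j : Matrix (Fin 2) (Fin 2) H →ₐ[k] Matrix (Fin 2) (Fin 2) (H ⊗[k] H) :=
    (Algebra.TensorProduct.includeLeft : H →ₐ[k] H ⊗[k] H).mapMatrix
  let sc : H →ₐ[k] Matrix (Fin 2) (Fin 2) (H ⊗[k] H) :=
    diagAlgHom Algebra.TensorProduct.includeRight Algebra.TensorProduct.includeRight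
  let θ := FreeAdjoin.lift (dΘ.toLieHom.comp ι) (cornerUnit _)
  let ψ := FreeAdjoin.lift (dΨ.toLieHom.comp ι) (cornerUnit _)
  let ψ₂ := FreeAdjoin.lift ι 0
  -- Both sides are Lie morphisms because the summands commute, so it is enough to compare them on
  -- `L` and on `x`. The identity concerns Lie elements only, whence the need for `[a, x]` to be
  -- one.
  have hsum : θ = addCommuting (j.toLieHom.comp ψ) (sc.toLieHom.comp ψ₂)
      fun x y => commute_scalar _ _ := by
    refine FreeAdjoin.hom_ext (fun x => ?_) ?_
    · change θ _ = j (ψ _) + sc (ψ₂ _)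
      simp only [θ, ψ, ψ₂, FreeAdjoin.lift_incl]
      change dΘ (ι x) = j (dΨ (ι x)) + sc (ι x)
      exact diagAlgHom_of_primitive (comul_ι k L x) (counit_ι k L x)
    · change θ _ = j (ψ _) + sc (ψ₂ _)
      simp only [θ, ψ, ψ₂, FreeAdjoin.lift_var]
      exact cornerUnit_eq_add _
  refine primitive_of_commutator (Δ := comul k L) (ε := counit k L)
    (φ := envelopingMap (FreeAdjoin.incl k L))
    (X := UniversalEnvelopingAlgebra.ι k (FreeAdjoin.var k L))
    (Θ := UniversalEnvelopingAlgebra.lift k θ) (Ψ := UniversalEnvelopingAlgebra.lift k ψ)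
    (enveloping_algHom_ext fun x => ?_) ?_ (enveloping_algHom_ext fun x => ?_) ?_ ha0 ⟨ψ₂ w, ?_⟩
  · rw [AlgHom.comp_apply, envelopingMap_ι, UniversalEnvelopingAlgebra.lift_ι_apply]
    exact FreeAdjoin.lift_incl _ _ x
  · rw [UniversalEnvelopingAlgebra.lift_ι_apply]
    exact FreeAdjoin.lift_var _ _
  · rw [AlgHom.comp_apply, envelopingMap_ι, UniversalEnvelopingAlgebra.lift_ι_apply]
    exact FreeAdjoin.lift_incl _ _ x
  · rw [UniversalEnvelopingAlgebra.lift_ι_apply]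
    exact FreeAdjoin.lift_var _ _
  · rw [← hw, UniversalEnvelopingAlgebra.lift_ι_apply, UniversalEnvelopingAlgebra.lift_ι_apply, hsum]
    rfl

theorem isUniversallyDerivative_ι (x : L) :
    IsUniversallyDerivative k L (UniversalEnvelopingAlgebra.ι k x) :=
  ⟨⁅FreeAdjoin.incl k L x, FreeAdjoin.var k L⁆, by
    rw [LieHom.map_lie, envelopingMap_ι, LieRing.of_associative_ring_bracket]⟩

theorem isUniversallyDerivative_iff [CharZero k] (a : UniversalEnvelopingAlgebra k L) :
    (counit k L a = 0 ∧ IsUniversallyDerivative k L a) ↔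
      a ∈ Set.range (UniversalEnvelopingAlgebra.ι k : L → UniversalEnvelopingAlgebra k L) := by
  constructor
  · rintro ⟨h0, h⟩
    exact mem_range_ι_of_primitive k L (comul_eq_of_isUniversallyDerivative h0 h) h0
  · rintro ⟨x, rfl⟩
    exact ⟨counit_ι k L x, isUniversallyDerivative_ι x⟩

end PartOne

/-! ### Universally derivative elements of `U_p(L)` -/

section RestrictedPartOne

variable {k : Type*} [Field k] {p : ℕ} [hp : Fact p.Prime] [CharP k p]
  {L : Type*} [LieRing L] [LieAlgebra k L] [RestrictedLieAlgebra k p L]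

attribute [local instance] RestrictedLieAlgebra.ofAssociativeAlgebra

theorem pMap_eq_pow {A : Type*} [Ring A] [Algebra k A] (x : A) : pMap k p x = x ^ p := rfl

theorem restrictedEnvelopingMap_ι {L' : Type*} [LieRing L'] [LieAlgebra k L']
    [RestrictedLieAlgebra k p L'] (f : RestrictedLieHom k p L L') (x : L) :
    restrictedEnvelopingMap f (restrictedι k p x) = restrictedι k p (f.toLieHom x) := by
  refine (RingQuot.liftAlgHom_mkAlgHom_apply k _ _ _).trans ?_
  rw [AlgHom.comp_apply, envelopingMap_ι]
  rfl

theorem restrictedEnveloping_algHom_ext {A : Type*} [Ring A] [Algebra k A]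
    {F G : RestrictedEnvelopingAlgebra k p L →ₐ[k] A}
    (h : ∀ x, F (restrictedι k p x) = G (restrictedι k p x)) : F = G :=
  RingQuot.ringQuot_ext' k _ _ (enveloping_algHom_ext h)

/-- The canonical morphism from `L` to its restricted enveloping algebra, followed by a
homomorphism of algebras. -/
def restrictedHomOfAlgHom {A : Type*} [Ring A] [Algebra k A]
    (F : RestrictedEnvelopingAlgebra k p L →ₐ[k] A) : RestrictedLieHom k p L A where
  toLieHom := F.toLieHom.comp (restrictedιHom k L p)
  map_pMap x := by
    change F (restrictedι k p _) = F (restrictedι k p _) ^ p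
    rw [restrictedι_pMap, map_pow]

/-- The extension of a morphism to the restricted enveloping algebra. -/
def algHomOfRestrictedHom {A : Type*} [Ring A] [Algebra k A] (f : RestrictedLieHom k p L A) :
    RestrictedEnvelopingAlgebra k p L →ₐ[k] A :=
  restrictedLift f.toLieHom f.map_pMap

theorem algHomOfRestrictedHom_ι {A : Type*} [Ring A] [Algebra k A] (f : RestrictedLieHom k p L A)
    (x : L) : algHomOfRestrictedHom f (restrictedι k p x) = f.toLieHom x :=
  restrictedLift_ι _ _ _

/-- The sum of two morphisms of restricted Lie algebras with commuting images. -/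
def restrictedAddCommuting {A : Type*} [Ring A] [Algebra k A] (f g : RestrictedLieHom k p L A)
    (h : ∀ x y, Commute (f.toLieHom x) (g.toLieHom y)) : RestrictedLieHom k p L A where
  toLieHom := addCommuting f.toLieHom g.toLieHom h
  map_pMap x := by
    change f.toLieHom _ + g.toLieHom _ = (f.toLieHom x + g.toLieHom x) ^ p
    rw [f.map_pMap, g.map_pMap, add_pow_prime_of_commute k p (h x x)]
    rfl

/-- A homomorphism of algebras as a morphism of restricted Lie algebras. -/
def AlgHom.toRestrictedLieHom {A B : Type*} [Ring A] [Algebra k A] [Ring B] [Algebra k B]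
    (F : A →ₐ[k] B) : RestrictedLieHom k p A B where
  toLieHom := F.toLieHom
  map_pMap x := map_pow F x p

theorem restrictedComul_eq_of_isRestrictedUniversallyDerivative
    {a : RestrictedEnvelopingAlgebra k p L} (ha0 : restrictedCounit k p L a = 0)
    (ha : IsRestrictedUniversallyDerivative k p L a) :
    restrictedComul k L p a = a ⊗ₜ 1 + 1 ⊗ₜ a := by
  obtain ⟨w, hw⟩ := ha
  let H := RestrictedEnvelopingAlgebra k p L
  let dΘ : H →ₐ[k] Matrix (Fin 2) (Fin 2) (H ⊗[k] H) :=
    diagAlgHom (restrictedComul k L p) Algebra.TensorProduct.includeRight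
  let dΨ : H →ₐ[k] Matrix (Fin 2) (Fin 2) H :=
    diagAlgHom (AlgHom.id k _) ((Algebra.ofId k _).comp (restrictedCounit k p L))
  let j : Matrix (Fin 2) (Fin 2) H →ₐ[k] Matrix (Fin 2) (Fin 2) (H ⊗[k] H) :=
    (Algebra.TensorProduct.includeLeft : H →ₐ[k] H ⊗[k] H).mapMatrix
  let sc : H →ₐ[k] Matrix (Fin 2) (Fin 2) (H ⊗[k] H) :=
    diagAlgHom Algebra.TensorProduct.includeRight Algebra.TensorProduct.includeRight
  let θ := RestrictedFreeAdjoin.lift (restrictedHomOfAlgHom dΘ) (cornerUnit _)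
  let ψ := RestrictedFreeAdjoin.lift (restrictedHomOfAlgHom dΨ) (cornerUnit _)
  let ψ₂ := RestrictedFreeAdjoin.lift (restrictedHomOfAlgHom (AlgHom.id k H)) 0
  -- Commutation of the summands makes their sum compatible with the `p`-operation as well as with
  -- the bracket.
  have hsum : ∀ z, θ.toLieHom z = j (ψ.toLieHom z) + sc (ψ₂.toLieHom z) := by
    refine RestrictedFreeAdjoin.hom_ext (f := θ)
      (g := restrictedAddCommuting ((AlgHom.toRestrictedLieHom j).comp ψ)
        ((AlgHom.toRestrictedLieHom sc).comp ψ₂) fun x y => commute_scalar _ _) (fun x => ?_) ?_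
    · exact diagAlgHom_of_primitive (restrictedComul_ι k L p x) (restrictedCounit_ι k L p x)
    · exact cornerUnit_eq_add H
  refine primitive_of_commutator (Δ := restrictedComul k L p) (ε := restrictedCounit k p L)
    (φ := restrictedEnvelopingMap (RestrictedFreeAdjoin.incl k p L))
    (X := restrictedι k p (RestrictedFreeAdjoin.var k p L))
    (Θ := algHomOfRestrictedHom θ) (Ψ := algHomOfRestrictedHom ψ)
    (restrictedEnveloping_algHom_ext fun x => ?_) ?_
    (restrictedEnveloping_algHom_ext fun x => ?_) ?_ ha0 ⟨ψ₂.toLieHom w, ?_⟩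
  · rw [AlgHom.comp_apply, restrictedEnvelopingMap_ι, algHomOfRestrictedHom_ι]
    rfl
  · rw [algHomOfRestrictedHom_ι]
    rfl
  · rw [AlgHom.comp_apply, restrictedEnvelopingMap_ι, algHomOfRestrictedHom_ι]
    rfl
  · rw [algHomOfRestrictedHom_ι]
    rfl
  · rw [← hw, algHomOfRestrictedHom_ι, algHomOfRestrictedHom_ι]
    exact hsum w

theorem isRestrictedUniversallyDerivative_ι (x : L) :
    IsRestrictedUniversallyDerivative k p L (restrictedι k p x) :=
  ⟨⁅(RestrictedFreeAdjoin.incl k p L).toLieHom x, RestrictedFreeAdjoin.var k p L⁆, by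
    rw [restrictedEnvelopingMap_ι, ← restrictedιHom_apply, LieHom.map_lie,
      LieRing.of_associative_ring_bracket]
    rfl⟩

theorem isRestrictedUniversallyDerivative_iff (a : RestrictedEnvelopingAlgebra k p L) :
    (restrictedCounit k p L a = 0 ∧ IsRestrictedUniversallyDerivative k p L a) ↔
      a ∈ Set.range (restrictedι k p : L →ₗ[k] RestrictedEnvelopingAlgebra k p L) := by
  constructor
  · rintro ⟨h0, h⟩
    exact mem_range_restrictedι_of_primitive k L p
      (restrictedComul_eq_of_isRestrictedUniversallyDerivative h0 h) h0
  · rintro ⟨x, rfl⟩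
    exact ⟨restrictedCounit_ι k L p x, isRestrictedUniversallyDerivative_ι x⟩

end RestrictedPartOne

/-! ### Extended derivations are inner -/

section Row

variable (k : Type*) [Field k] {H H' : Type*} [Ring H] [Algebra k H] [Ring H'] [Algebra k H']

variable (H) in
/-- The Lie algebra of `2 × 2` matrices with vanishing second row. -/
def rowAlgebra : LieSubalgebra k (Matrix (Fin 2) (Fin 2) H) where
  carrier := {T | ∀ j, T 1 j = 0}
  add_mem' hS hT j := by simp [hS j, hT j]
  zero_mem' j := rfl
  smul_mem' c T hT j := by simp [hT j]
  lie_mem' {S T} hS hT j := by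
    simp [LieRing.of_associative_ring_bracket, Matrix.mul_apply, hS _, hT _]

variable {k}

theorem rowAlgebra_apply (T : rowAlgebra k H) (j : Fin 2) : T.1 1 j = 0 := T.2 j

theorem rowAlgebra_ext {S T : rowAlgebra k H} (h : ∀ j, S.1 0 j = T.1 0 j) : S = T := by
  apply Subtype.ext
  ext i j
  fin_cases i
  · exact h j
  · exact (S.2 j).trans (T.2 j).symm

theorem rowAlgebra_lie_apply (S T : rowAlgebra k H) (j : Fin 2) :
    (⁅S, T⁆ : rowAlgebra k H).1 0 j = S.1 0 0 * T.1 0 j - T.1 0 0 * S.1 0 j := by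
  rw [LieSubalgebra.coe_bracket, LieRing.of_associative_ring_bracket]
  simp [Matrix.mul_apply, Fin.sum_univ_two, rowAlgebra_apply]

variable (k) in
/-- The matrix with entry `r` in the upper right corner. -/
def rowCorner (r : H) : rowAlgebra k H :=
  ⟨!![0, r; 0, 0], fun j => by fin_cases j <;> rfl⟩

variable (k H) in
/-- The embedding of an algebra in the upper left corner. -/
def rowIncl : H →ₗ⁅k⁆ rowAlgebra k H where
  toFun h := ⟨!![h, 0; 0, 0], fun j => by fin_cases j <;> rfl⟩
  map_add' x y := rowAlgebra_ext fun j => by fin_cases j <;> simp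
  map_smul' c x := rowAlgebra_ext fun j => by fin_cases j <;> simp
  map_lie' {x y} := rowAlgebra_ext fun j => by
    rw [rowAlgebra_lie_apply]
    fin_cases j <;> simp [LieRing.of_associative_ring_bracket]

variable (k H) in
/-- The entry in the upper left corner. -/
def rowFst : rowAlgebra k H →ₗ⁅k⁆ H where
  toFun T := T.1 0 0
  map_add' _ _ := rfl
  map_smul' _ _ := rfl
  map_lie' {x y} := rowAlgebra_lie_apply x y 0

/-- The entrywise application of a homomorphism of algebras. -/
def rowMap (φ : H →ₐ[k] H') : rowAlgebra k H →ₗ⁅k⁆ rowAlgebra k H' where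
  toFun T := ⟨φ.mapMatrix T.1, fun j => by simp [rowAlgebra_apply]⟩
  map_add' x y := Subtype.ext (map_add φ.mapMatrix x.1 y.1)
  map_smul' c x := Subtype.ext (map_smul φ.mapMatrix c x.1)
  map_lie' {x y} := rowAlgebra_ext fun j => by
    rw [rowAlgebra_lie_apply]
    change φ ((⁅x, y⁆ : rowAlgebra k H).1 0 j) = _
    rw [rowAlgebra_lie_apply, map_sub, map_mul, map_mul]
    rfl

/-- Only the first column of the left factor matters. For `d = diag(1, r)` this gives `(S d) (T d) =
S T d`, so right multiplication by `d` is a morphism. -/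
theorem diagonal_mul_row (r : H) (T : rowAlgebra k H) :
    !![1, 0; 0, r] * T.1 = T.1 := by
  ext i j
  fin_cases i <;> simp [Matrix.mul_apply, Fin.sum_univ_two, rowAlgebra_apply]

/-- The right multiplication by the diagonal matrix with entries `1` and `r`. -/
def rowMul (r : H) : rowAlgebra k H →ₗ⁅k⁆ rowAlgebra k H where
  toFun T := ⟨T.1 * !![1, 0; 0, r], fun j => by
    simp [Matrix.mul_apply, rowAlgebra_apply]⟩
  map_add' x y := Subtype.ext (add_mul x.1 y.1 _)
  map_smul' c x := Subtype.ext (smul_mul_assoc c x.1 _)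
  map_lie' {x y} := by
    apply Subtype.ext
    simp only [LieSubalgebra.coe_bracket, LieRing.of_associative_ring_bracket, sub_mul]
    rw [mul_assoc x.1 _ (y.1 * _), ← mul_assoc _ y.1, diagonal_mul_row, mul_assoc y.1 _ (x.1 * _),
      ← mul_assoc _ x.1, diagonal_mul_row, mul_assoc, mul_assoc]

theorem rowIncl_mul (x y : H) :
    (rowIncl k H (x * y)).1 = (rowIncl k H x).1 * (rowIncl k H y).1 := by
  ext i j
  fin_cases i <;> fin_cases j <;> simp [rowIncl]

theorem rowMap_incl (φ : H →ₐ[k] H') (h : H) :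
    rowMap φ (rowIncl k H h) = rowIncl k H' (φ h) :=
  rowAlgebra_ext fun j => by fin_cases j <;> simp [rowMap, rowIncl]

theorem rowMap_corner (φ : H →ₐ[k] H') (h : H) :
    rowMap φ (rowCorner k h) = rowCorner k (φ h) :=
  rowAlgebra_ext fun j => by fin_cases j <;> simp [rowMap, rowCorner]

theorem rowMul_incl (r h : H) : rowMul r (rowIncl k H h) = rowIncl k H h :=
  rowAlgebra_ext fun j => by fin_cases j <;> simp [rowMul, rowIncl]

theorem rowMul_corner (r h : H) : rowMul r (rowCorner k h) = rowCorner k (h * r) :=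
  rowAlgebra_ext fun j => by fin_cases j <;> simp [rowMul, rowCorner]

theorem rowFst_corner (h : H) : rowFst k H (rowCorner k h) = 0 := rfl

theorem lie_rowIncl_corner (h m : H) : ⁅rowIncl k H h, rowCorner k m⁆ = rowCorner k (h * m) :=
  rowAlgebra_ext fun j => by
    rw [rowAlgebra_lie_apply]
    fin_cases j <;> simp [rowIncl, rowCorner]

theorem eq_rowCorner_of_fst {T : rowAlgebra k H} (h : rowFst k H T = 0) :
    T = rowCorner k (T.1 0 1) :=
  rowAlgebra_ext fun j => by
    fin_cases j
    · exact h.trans (by simp [rowCorner])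
    · simp [rowCorner]

/-- A derivation of `rowAlgebra` that acts on the corner by left multiplication by `h` acts on the
image of `H` by the commutator with `h`. -/
theorem commutator_of_derivation (D : LieDerivation k (rowAlgebra k H) (rowAlgebra k H)) {h x y : H}
    (hcorner : ∀ r, D (rowCorner k r) = rowCorner k (h * r))
    (hx : D (rowIncl k H x) = rowIncl k H y) : y = h * x - x * h := by
  -- Differentiating `[x, corner 1] = corner x` gives `h * x = x * h + y` in the corner.
  have h1 := D.apply_lie_eq_add (rowIncl k H x) (rowCorner k 1)
  rw [hx, hcorner, lie_rowIncl_corner, lie_rowIncl_corner, lie_rowIncl_corner, hcorner] at h1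
  have h2 := congrArg (fun T => T.1 0 1) h1
  simp [rowCorner] at h2
  rw [h2, add_sub_cancel_left]

end Row

/-! ### Extended derivations of Lie algebras -/

section PartTwo

variable {k : Type u} [Field k] {L : Type v} [LieRing L] [LieAlgebra k L]

theorem innerExtendedDerivation_apply (a : L) (L' : Type (max u v)) [LieRing L'] [LieAlgebra k L']
    (f : L →ₗ⁅k⁆ L') (l : L') : (innerExtendedDerivation k L a).1 L' f l = ⁅f a, l⁆ :=
  LieDerivation.ad_apply_apply k L' (f a) l

/-- The element `h` is read off from the derivation of the row algebra over `U(L)`, at the corner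
element `1`; naturality transports it to every `L'`. -/
theorem exists_commutator_of_extendedDerivation (D : ExtendedDerivation k L) :
    ∃ h : UniversalEnvelopingAlgebra k L, ∀ (L' : Type (max u v)) [LieRing L'] [LieAlgebra k L']
      (f : L →ₗ⁅k⁆ L') (l : L'), UniversalEnvelopingAlgebra.ι k (D.1 L' f l) =
        envelopingMap f h * UniversalEnvelopingAlgebra.ι k l -
          UniversalEnvelopingAlgebra.ι k l * envelopingMap f h := by
  let H := UniversalEnvelopingAlgebra k L
  let f₀ : L →ₗ⁅k⁆ rowAlgebra k H := (rowIncl k H).comp (UniversalEnvelopingAlgebra.ι k)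
  -- The projection to the upper left entry kills the corner, so by naturality it also kills the
  -- derivative of the corner.
  have hfst : rowFst k H (D.1 (rowAlgebra k H) f₀ (rowCorner k 1)) = 0 := by
    rw [D.2 (rowAlgebra k H) H f₀ (rowFst k H), rowFst_corner, map_zero]
  have hcorner := eq_rowCorner_of_fst hfst
  refine ⟨(D.1 (rowAlgebra k H) f₀ (rowCorner k 1)).1 0 1, ?_⟩
  generalize (D.1 (rowAlgebra k H) f₀ (rowCorner k 1)).1 0 1 = h at hcorner
  intro L' _ _ f l
  let H' := UniversalEnvelopingAlgebra k L'
  let g : L' →ₗ⁅k⁆ rowAlgebra k H' := (rowIncl k H').comp (UniversalEnvelopingAlgebra.ι k)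
  refine commutator_of_derivation (D.1 (rowAlgebra k H') (g.comp f)) (fun r => ?_)
    (D.2 L' (rowAlgebra k H') f g l).symm
  have e1 : (rowMap (envelopingMap f)).comp f₀ = g.comp f := LieHom.ext fun x => by
    change rowMap _ (rowIncl k H (UniversalEnvelopingAlgebra.ι k x)) = _
    rw [rowMap_incl, envelopingMap_ι]
    rfl
  have e2 : (rowMul r).comp (g.comp f) = g.comp f := LieHom.ext fun x => rowMul_incl r _
  -- Naturality along the entrywise map from `U(L)` to `U(L')` gives the value at the corner element
  -- `1` over `U(L')`.
  have h1 := D.2 _ _ f₀ (rowMap (envelopingMap f)) (rowCorner k 1)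
  rw [hcorner, rowMap_corner, rowMap_corner, map_one, e1] at h1
  -- Right multiplication by `diag(1, r)` fixes the structure morphism and moves the corner element
  -- `1` to `r`, so left multiplication by the image of `h` describes the derivation on the whole
  -- corner.
  have h2 := D.2 _ _ (g.comp f) (rowMul r) (rowCorner k 1)
  rw [← h1, rowMul_corner, rowMul_corner, one_mul, e2] at h2
  exact h2.symm

theorem IsUniversallyDerivative.sub_algebraMap {a : UniversalEnvelopingAlgebra k L}
    (ha : IsUniversallyDerivative k L a) (c : k) :
    IsUniversallyDerivative k L (a - algebraMap k _ c) := by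
  rw [IsUniversallyDerivative, map_sub, AlgHom.commutes, sub_mul, mul_sub, Algebra.commutes c,
    sub_sub_sub_cancel_right]
  exact ha

theorem bijective_innerExtendedDerivation [CharZero k] :
    Function.Bijective (innerExtendedDerivation k L) := by
  constructor
  · rw [injective_iff_map_eq_zero]
    intro a ha
    let H := UniversalEnvelopingAlgebra k L
    let f₀ : L →ₗ⁅k⁆ rowAlgebra k H := (rowIncl k H).comp (UniversalEnvelopingAlgebra.ι k)
    -- Bracketing with the corner element `1` recovers `a` as a corner entry, so a vanishing family
    -- forces `a = 0`.
    have h1 : ⁅rowIncl k H (UniversalEnvelopingAlgebra.ι k a), rowCorner k (1 : H)⁆ = 0 :=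
      (innerExtendedDerivation_apply a _ f₀ _).symm.trans <|
        congrArg (fun D : ExtendedDerivation k L => D.1 (rowAlgebra k H) f₀ (rowCorner k 1)) ha
    rw [lie_rowIncl_corner, mul_one] at h1
    have h2 := congrArg (fun T => T.1 0 1) h1
    apply enveloping_ι_injective k L
    rw [map_zero]
    exact h2
  · intro D
    obtain ⟨h, hD⟩ := exists_commutator_of_extendedDerivation D
    have hder : IsUniversallyDerivative k L h :=
      ⟨_, hD (FreeAdjoin k L) (FreeAdjoin.incl k L) (FreeAdjoin.var k L)⟩
    -- Subtracting the constant `ε(h)` changes no commutator and makes part 1 applicable.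
    obtain ⟨a, ha⟩ := (isUniversallyDerivative_iff (h - algebraMap k _ (counit k L h))).1
      ⟨by rw [map_sub, AlgHom.commutes, Algebra.algebraMap_self_apply, sub_self],
        hder.sub_algebraMap _⟩
    refine ⟨a, Subtype.ext ?_⟩
    funext L' _ _ f
    ext l
    apply enveloping_ι_injective k L'
    rw [innerExtendedDerivation_apply, hD L' f l, LieHom.map_lie, LieRing.of_associative_ring_bracket, ← envelopingMap_ι, ha,
      map_sub, AlgHom.commutes, sub_mul, mul_sub, Algebra.commutes, sub_sub_sub_cancel_right]

end PartTwo

/-! ### Extended derivations of restricted Lie algebras -/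

section RestrictedPartTwo

variable {k : Type u} [Field k] {p : ℕ} [hp : Fact p.Prime] [CharP k p]

attribute [local instance] RestrictedLieAlgebra.ofAssociativeAlgebra

theorem RestrictedLieHom.ext' {L : Type*} [LieRing L] [LieAlgebra k L] [RestrictedLieAlgebra k p L]
    {L' : Type*} [LieRing L'] [LieAlgebra k L'] [RestrictedLieAlgebra k p L']
    {f g : RestrictedLieHom k p L L'} (h : ∀ x, f.toLieHom x = g.toLieHom x) : f = g := by
  cases f
  cases g
  congr
  exact LieHom.ext h

/-- A Lie subalgebra of an associative algebra that is closed under `p`-th powers is a restricted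
Lie algebra. -/
@[reducible]
def RestrictedLieAlgebra.ofLieSubalgebra {A : Type*} [Ring A] [Algebra k A]
    (K : LieSubalgebra k A) (hK : ∀ x ∈ K, x ^ p ∈ K) : RestrictedLieAlgebra k p K where
  pMap x := ⟨x.1 ^ p, hK x.1 x.2⟩
  pMap_smul c x := Subtype.ext (smul_pow c x.1 p)
  pMap_add x y := by
    -- The inclusion is an injective Lie morphism, so the axiom can be checked in `A`, where it is
    -- Jacobson's formula.
    have h : K.incl (∑ i ∈ Finset.Icc 1 (p - 1), jacobsonS k p i x y) =
        ∑ i ∈ Finset.Icc 1 (p - 1), jacobsonS k p i x.1 y.1 := by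
      rw [map_sum]
      simp only [map_jacobsonS]
      rfl
    refine Subtype.ext ((add_pow_prime k p x.1 y.1).trans ?_)
    rw [← h]
    rfl
  ad_pMap x := by
    ext y
    change ⁅x.1 ^ p, y.1⁆ = K.incl _
    rw [map_ad_pow_apply, ← LieAlgebra.ad_apply k, ad_pow_prime k p]
    rfl

variable {H H' : Type*} [Ring H] [Algebra k H] [Ring H'] [Algebra k H']

instance : RestrictedLieAlgebra k p (rowAlgebra k H) :=
  RestrictedLieAlgebra.ofLieSubalgebra _ fun x hx j => by
    obtain ⟨n, hn⟩ := Nat.exists_eq_succ_of_ne_zero hp.out.ne_zero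
    -- The second row of `x ^ p` is that of the first factor times a matrix; this needs `p ≠ 0`.
    rw [hn, pow_succ', Matrix.mul_apply]
    exact Finset.sum_eq_zero fun i _ => by rw [hx i, zero_mul]

theorem coe_pMap_rowAlgebra (T : rowAlgebra k H) : (pMap k p T).1 = T.1 ^ p := rfl

variable (k p H) in
/-- The embedding of an algebra in the upper left corner. -/
def restrictedRowIncl : RestrictedLieHom k p H (rowAlgebra k H) where
  toLieHom := rowIncl k H
  map_pMap x := by
    apply Subtype.ext
    rw [coe_pMap_rowAlgebra, pMap_eq_pow]
    obtain ⟨n, hn⟩ := Nat.exists_eq_succ_of_ne_zero hp.out.ne_zero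
    rw [hn]
    -- The embedding is multiplicative but not unital, so exponents start at `1`.
    have key : ∀ m : ℕ, (rowIncl k H (x ^ (m + 1))).1 = (rowIncl k H x).1 ^ (m + 1) := by
      intro m
      induction m with
      | zero => simp
      | succ m ih => rw [pow_succ x, rowIncl_mul, ih, ← pow_succ]
    exact key n

variable (k p H) in
/-- The entry in the upper left corner. -/
def restrictedRowFst : RestrictedLieHom k p (rowAlgebra k H) H where
  toLieHom := rowFst k H
  map_pMap T := by
    change (T.1 ^ p) 0 0 = (T.1 0 0) ^ p
    have key : ∀ m : ℕ, (T.1 ^ m) 0 0 = (T.1 0 0) ^ m := by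
      intro m
      induction m with
      | zero => simp
      | succ m ih =>
        rw [pow_succ, Matrix.mul_apply, Fin.sum_univ_two, ih, rowAlgebra_apply, mul_zero, add_zero,
          pow_succ]
    exact key p

variable (p) in
/-- The entrywise application of a homomorphism of algebras. -/
def restrictedRowMap (φ : H →ₐ[k] H') :
    RestrictedLieHom k p (rowAlgebra k H) (rowAlgebra k H') where
  toLieHom := rowMap φ
  map_pMap T := Subtype.ext (map_pow φ.mapMatrix T.1 p)

variable (p) in
/-- The right multiplication by the diagonal matrix with entries `1` and `r`. -/
def restrictedRowMul (r : H) : RestrictedLieHom k p (rowAlgebra k H) (rowAlgebra k H) where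
  toLieHom := rowMul r
  map_pMap T := by
    apply Subtype.ext
    change T.1 ^ p * !![1, 0; 0, r] = (T.1 * !![1, 0; 0, r]) ^ p
    obtain ⟨n, hn⟩ := Nat.exists_eq_succ_of_ne_zero hp.out.ne_zero
    rw [hn, Nat.succ_eq_add_one]
    clear hn
    -- The identity fails for exponent `0` in general; the induction starts at exponent `1`.
    induction n with
    | zero => simp
    | succ n ih =>
      rw [pow_succ _ (n + 1), pow_succ _ (n + 1), ← ih, mul_assoc (T.1 ^ (n + 1)) _ (T.1 * _),
        ← mul_assoc _ T.1, diagonal_mul_row, mul_assoc]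

variable {L : Type v} [LieRing L] [LieAlgebra k L] [RestrictedLieAlgebra k p L]

theorem innerRestrictedExtendedDerivation_apply (a : L) (L' : Type (max u v)) [LieRing L']
    [LieAlgebra k L'] [RestrictedLieAlgebra k p L'] (f : RestrictedLieHom k p L L') (l : L') :
    (innerRestrictedExtendedDerivation k L p a).1 L' f l = ⁅f.toLieHom a, l⁆ :=
  LieDerivation.ad_apply_apply k L' (f.toLieHom a) l

theorem exists_commutator_of_restrictedExtendedDerivation (D : RestrictedExtendedDerivation k L p) :
    ∃ h : RestrictedEnvelopingAlgebra k p L, ∀ (L' : Type (max u v)) [LieRing L'] [LieAlgebra k L']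
      [RestrictedLieAlgebra k p L'] (f : RestrictedLieHom k p L L') (l : L'),
        restrictedι k p (D.1 L' f l) = restrictedEnvelopingMap f h * restrictedι k p l -
          restrictedι k p l * restrictedEnvelopingMap f h := by
  let H := RestrictedEnvelopingAlgebra k p L
  let f₀ : RestrictedLieHom k p L (rowAlgebra k H) :=
    (restrictedRowIncl k p H).comp (restrictedHomOfAlgHom (AlgHom.id k H))
  have hfst : rowFst k H (D.1 (rowAlgebra k H) f₀ (rowCorner k 1)) = 0 := by
    have := D.2 (rowAlgebra k H) H f₀ (restrictedRowFst k p H) (rowCorner k 1)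
    refine this.trans ?_
    rw [restrictedRowFst, rowFst_corner, map_zero]
  have hcorner := eq_rowCorner_of_fst hfst
  refine ⟨(D.1 (rowAlgebra k H) f₀ (rowCorner k 1)).1 0 1, ?_⟩
  generalize (D.1 (rowAlgebra k H) f₀ (rowCorner k 1)).1 0 1 = h at hcorner
  intro L' _ _ _ f l
  let H' := RestrictedEnvelopingAlgebra k p L'
  let g : RestrictedLieHom k p L' (rowAlgebra k H') :=
    (restrictedRowIncl k p H').comp (restrictedHomOfAlgHom (AlgHom.id k H'))
  refine commutator_of_derivation (D.1 (rowAlgebra k H') (g.comp f)) (fun r => ?_)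
    (D.2 L' (rowAlgebra k H') f g l).symm
  have e1 : (restrictedRowMap p (restrictedEnvelopingMap f)).comp f₀ = g.comp f :=
    RestrictedLieHom.ext' fun x => by
      change rowMap _ (rowIncl k H (restrictedι k p x)) = _
      rw [rowMap_incl, restrictedEnvelopingMap_ι]
      rfl
  have e2 : (restrictedRowMul p r).comp (g.comp f) = g.comp f :=
    RestrictedLieHom.ext' fun x => rowMul_incl r _
  have h1 := D.2 _ _ f₀ (restrictedRowMap p (restrictedEnvelopingMap f)) (rowCorner k 1)
  rw [hcorner, restrictedRowMap, rowMap_corner, rowMap_corner, map_one, ← restrictedRowMap, e1] at h1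
  have h2 := D.2 _ _ (g.comp f) (restrictedRowMul p r) (rowCorner k 1)
  rw [← h1, e2, restrictedRowMul, rowMul_corner, rowMul_corner, one_mul] at h2
  exact h2.symm

theorem IsRestrictedUniversallyDerivative.sub_algebraMap {a : RestrictedEnvelopingAlgebra k p L}
    (ha : IsRestrictedUniversallyDerivative k p L a) (c : k) :
    IsRestrictedUniversallyDerivative k p L (a - algebraMap k _ c) := by
  rw [IsRestrictedUniversallyDerivative, map_sub, AlgHom.commutes, sub_mul, mul_sub,
    Algebra.commutes c, sub_sub_sub_cancel_right]
  exact ha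

theorem bijective_innerRestrictedExtendedDerivation :
    Function.Bijective (innerRestrictedExtendedDerivation k L p) := by
  constructor
  · rw [injective_iff_map_eq_zero]
    intro a ha
    let H := RestrictedEnvelopingAlgebra k p L
    let f₀ : RestrictedLieHom k p L (rowAlgebra k H) :=
      (restrictedRowIncl k p H).comp (restrictedHomOfAlgHom (AlgHom.id k H))
    have h1 : ⁅rowIncl k H (restrictedι k p a), rowCorner k (1 : H)⁆ = 0 :=
      (innerRestrictedExtendedDerivation_apply a _ f₀ _).symm.trans <|
        congrArg (fun D : RestrictedExtendedDerivation k L p =>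
        D.1 (rowAlgebra k H) f₀ (rowCorner k 1)) ha
    rw [lie_rowIncl_corner, mul_one] at h1
    have h2 := congrArg (fun T => T.1 0 1) h1
    apply restrictedι_injective k L p
    rw [map_zero]
    exact h2
  · intro D
    obtain ⟨h, hD⟩ := exists_commutator_of_restrictedExtendedDerivation D
    -- The commutator formula for the inclusion in `⟨L, x⟩`, evaluated at `x`.
    have hder : IsRestrictedUniversallyDerivative k p L h :=
      ⟨_, hD (RestrictedFreeAdjoin k p L) (RestrictedFreeAdjoin.incl k p L)
        (RestrictedFreeAdjoin.var k p L)⟩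
    obtain ⟨a, ha⟩ := (isRestrictedUniversallyDerivative_iff
      (h - algebraMap k _ (restrictedCounit k p L h))).1
      ⟨by rw [map_sub, AlgHom.commutes, Algebra.algebraMap_self_apply, sub_self],
        hder.sub_algebraMap _⟩
    refine ⟨a, Subtype.ext ?_⟩
    funext L' _ _ _ f
    ext l
    apply restrictedι_injective k L' p
    rw [innerRestrictedExtendedDerivation_apply, hD L' f l, ← restrictedιHom_apply, LieHom.map_lie, LieRing.of_associative_ring_bracket,
      restrictedιHom_apply, restrictedιHom_apply, ← restrictedEnvelopingMap_ι, ha,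
      map_sub, AlgHom.commutes, sub_mul, mul_sub, Algebra.commutes, sub_sub_sub_cancel_right]

end RestrictedPartTwo

end

end ExtLie

theorem mainTheorem1 (k : Type u) [Field k] (L : Type v) [LieRing L] [LieAlgebra k L] :
    (CharZero k →
      (∀ a : UniversalEnvelopingAlgebra k L,
        (ExtLie.counit k L a = 0 ∧ ExtLie.IsUniversallyDerivative k L a) ↔
          a ∈ Set.range (UniversalEnvelopingAlgebra.ι k : L → UniversalEnvelopingAlgebra k L)) ∧
      Function.Bijective (ExtLie.innerExtendedDerivation k L)) ∧
    (∀ (p : ℕ) [Fact p.Prime] [CharP k p] [ExtLie.RestrictedLieAlgebra k p L],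
      (∀ a : ExtLie.RestrictedEnvelopingAlgebra k p L,
        (ExtLie.restrictedCounit k p L a = 0 ∧ ExtLie.IsRestrictedUniversallyDerivative k p L a) ↔
          a ∈ Set.range
            (ExtLie.restrictedι k p : L →ₗ[k] ExtLie.RestrictedEnvelopingAlgebra k p L)) ∧
      Function.Bijective (ExtLie.innerRestrictedExtendedDerivation k L p)) :=
  ⟨fun _ => ⟨ExtLie.isUniversallyDerivative_iff, ExtLie.bijective_innerExtendedDerivation⟩,
    fun _ _ _ _ => ⟨ExtLie.isRestrictedUniversallyDerivative_iff,
      ExtLie.bijective_innerRestrictedExtendedDerivation⟩⟩
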